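/- **Conventions.** A map $f:X\to Y$ of metric spaces is Lipschitz if $d(f(x),f(y))\le L\,d(x,y)$ for some $L\ge 0$ and all $x,y$, and locally Lipschitz if every point of $X$ has a neighbourhood on which $f$ is Lipschitz. Let $\mathsf{Met}$ be the category of metric spaces and locally Lipschitz maps, and $\mathsf{Met}_2$ the category of pairs $(X,A)$, where $X$ is a metric space and $A\subset X$ is any subset (with the restricted metric), whose morphisms $(X,A)\to(Y,B)$ are the locally Lipschitz maps $f:X\to Y$ with $f(A)\subset B$. Let $S_*(X)$ be the singular chain complex of $X$ with integer coefficients and $S_*^L(X)\subset S_*(X)$ the subcomplex generated by the singular simplices $\sigma:\triangle^k\to X$ that are Lipschitz. Let $H_*$ and $H_*^L$ be the homology of $S_*$ and $S^L_*$; for pairs, $H_*(X,A)$ and $H^L_*(X,A)$ are the homology of $S_*(X)/S_*(A)$ and $S_*^L(X)/S_*^L(A)$. All of these are functors to abelian groups. Let $\tilde H_*^L(X)$ be the reduced singular Lipschitz homology, i.e. the homology of the augmented complex $\cdots\to S_1^L(X)\to S_0^L(X)\to\mathbb Z\to 0$, where $\sum_x a_x x\mapsto\sum_x a_x$. The inclusion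 $\iota:S_*^L\to S_*$ induces, for every $m\ge 0$, a natural transformation $\iota_*:H_m^L\to H_m$ of functors from $\mathsf{Met}_2$ to abelian groups. For a functor $H$ from $\mathsf{Met}$ to abelian groups, a metric space $X$ is *$(H)$-locally trivial* if for every $x\in X$ and every open $V\ni x$ there is an open $U$ with $x\in U\subset V$ such that the map $H(U)\to H(V)$ induced by the inclusion is zero. For $m\ge 0$ let $\mathsf{Met}_2^{[m]}$ be the full subcategory of $\mathsf{Met}_2$ of all pairs $(X,A)$ such that $X$ is $(\tilde H_j^L)$-locally trivial for $0\le j\le m$ and $(H_k)$-locally trivial for $1\le k\le m$, and $A$ is $(\tilde H_p^L)$-locally trivial for $0\le p\le m-1$ and $(H_q)$-locally trivial for $1\le q\le m$. A metric space $X$ is *weakly locally Lipschitz contractible* (WLLC) if for every $x\in X$ and every open $U\ni x$ there are an open $V$ with $x\in V\subset U$, a point $x_0\in U$, and a Lipschitz map $h:V\times[0,1]\to U$ with $h(v,0)=v$ and $h(v,1)=x_0$ for all $v\in V$. Let $\mathsf{Met}_2^{\mathrm{WLLC}}$ be the full subcategory of $\mathsf{Met}_2$ of all pairs $(X,A)$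 such that both $X$ and $A$ are WLLC. **Theorem.** Let $m\ge 0$. 1. On $\mathsf{Met}_2^{[m]}$, the natural transformation $\iota_*:H_m^L\to H_m$ is an isomorphism. 2. On $\mathsf{Met}_2^{\mathrm{WLLC}}$, the natural transformation $\iota_*:H_m^L\to H_m$ is an isomorphism. -/

import Mathlib

open CategoryTheory CategoryTheory.Limits

universe u

noncomputable section

namespace LipHomology

/-! ## The categories of metric spaces and of pairs, with locally Lipschitz maps -/

/-- A metric space, as an object of the category of metric spaces and locally Lipschitz maps. -/
structure LipMet : Type (u + 1) where
  of ::
  carrier : Type u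
  [metric : MetricSpace carrier]

instance : CoeSort LipMet.{u} (Type u) := ⟨LipMet.carrier⟩

instance (X : LipMet.{u}) : MetricSpace X := X.metric

/-- Morphisms of metric spaces: locally Lipschitz maps. -/
@[ext]
structure LipMet.Hom (X Y : LipMet.{u}) : Type u where
  toFun : X → Y
  locallyLipschitz : LocallyLipschitz toFun

instance : Category LipMet.{u} where
  Hom := LipMet.Hom
  id X := ⟨id, LocallyLipschitz.id⟩
  comp f g := ⟨g.toFun ∘ f.toFun, g.locallyLipschitz.comp f.locallyLipschitz⟩

@[ext]
theorem LipMet.hom_ext {X Y : LipMet.{u}} {f g : X ⟶ Y} (h : f.toFun = g.toFun) : f = g :=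
  LipMet.Hom.ext h

/-- A subset of a metric space, with the restricted metric. -/
def LipMet.sub (X : LipMet.{u}) (A : Set X) : LipMet.{u} := LipMet.of A

/-- The inclusion of a subset into a larger one. -/
def LipMet.subIncl (X : LipMet.{u}) {A B : Set X} (h : A ⊆ B) : X.sub A ⟶ X.sub B :=
  LipMet.Hom.mk (X := X.sub A) (Y := X.sub B) (Set.inclusion h)
    (LipschitzWith.of_edist_le (fun _ _ => le_rfl)).locallyLipschitz

/-- The inclusion of a subset into the whole space. -/
def LipMet.incl (X : LipMet.{u}) (A : Set X) : X.sub A ⟶ X :=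
  LipMet.Hom.mk (X := X.sub A) (Y := X) (Subtype.val : A → X)
    (LipschitzWith.of_edist_le (fun _ _ => le_rfl)).locallyLipschitz

/-- The functor to topological spaces. -/
def LipMet.toTop : LipMet.{u} ⥤ TopCat.{u} where
  obj X := TopCat.of X
  map f := TopCat.ofHom ⟨f.toFun, f.locallyLipschitz.continuous⟩

/-- A pair `(X, A)` of a metric space `X` and a subset `A` of `X`. -/
structure LipPair : Type (u + 1) where
  space : LipMet.{u}
  subset : Set space

/-- The subset of a pair, as a metric space. -/
def LipPair.subspace (P : LipPair.{u}) : LipMet.{u} := P.space.sub P.subset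

/-- Morphisms of pairs: locally Lipschitz maps `f : X → Y` with `f(A) ⊆ B`. -/
@[ext]
structure LipPair.Hom (P Q : LipPair.{u}) : Type u where
  hom : P.space ⟶ Q.space
  mapsTo : Set.MapsTo hom.toFun P.subset Q.subset

instance : Category LipPair.{u} where
  Hom := LipPair.Hom
  id P := ⟨𝟙 P.space, fun _ h => h⟩
  comp f g := ⟨f.hom ≫ g.hom, fun _ h => g.mapsTo (f.mapsTo h)⟩

@[ext]
theorem LipPair.hom_ext {P Q : LipPair.{u}} {f g : P ⟶ Q} (h : f.hom = g.hom) : f = g :=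
  LipPair.Hom.ext h

@[simp]
theorem LipPair.id_hom (P : LipPair.{u}) : LipPair.Hom.hom (𝟙 P) = 𝟙 P.space := rfl

@[simp]
theorem LipPair.comp_hom {P Q R : LipPair.{u}} (f : P ⟶ Q) (g : Q ⟶ R) :
    (f ≫ g).hom = f.hom ≫ g.hom := rfl

/-- The inclusion `A → X` of a pair `(X, A)`. -/
def LipPair.incl (P : LipPair.{u}) : P.subspace ⟶ P.space := P.space.incl P.subset

/-- The restriction `A → B` of a morphism `(X, A) → (Y, B)`. -/
def LipPair.Hom.restrict {P Q : LipPair.{u}} (f : P ⟶ Q) : P.subspace ⟶ Q.subspace :=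
  LipMet.Hom.mk (X := P.subspace) (Y := Q.subspace)
    (Set.MapsTo.restrict f.hom.toFun P.subset Q.subset f.mapsTo) (by
      intro x
      obtain ⟨K, t, ht, hK⟩ := f.hom.locallyLipschitz x.1
      refine ⟨K, Subtype.val ⁻¹' t, continuous_subtype_val.continuousAt.preimage_mem_nhds ht, ?_⟩
      intro a ha b hb
      exact hK ha hb)

@[simp]
theorem LipPair.restrict_id (P : LipPair.{u}) :
    LipPair.Hom.restrict (𝟙 P) = 𝟙 P.subspace := rfl

@[simp]
theorem LipPair.restrict_comp {P Q R : LipPair.{u}} (f : P ⟶ Q) (g : Q ⟶ R) :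
    LipPair.Hom.restrict (f ≫ g) = LipPair.Hom.restrict f ≫ LipPair.Hom.restrict g := rfl

theorem LipPair.restrict_incl {P Q : LipPair.{u}} (f : P ⟶ Q) :
    LipPair.Hom.restrict f ≫ Q.incl = P.incl ≫ f.hom := rfl

/-! ## Singular simplices and singular Lipschitz simplices -/

/-- The singular simplicial set of a metric space. -/
def singSSet : LipMet.{u} ⥤ SSet.{u} := LipMet.toTop ⋙ TopCat.toSSet

theorem lipschitzWith_stdSimplex_map {m n : ℕ} (f : Fin m → Fin n) :
    ∃ K, LipschitzWith K (stdSimplex.map (S := ℝ) f) := by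
  let L : (Fin m → ℝ) →L[ℝ] (Fin n → ℝ) :=
    LinearMap.toContinuousLinearMap (FunOnFinite.linearMap ℝ ℝ f)
  exact ⟨_, fun x y => L.lipschitz x.1 y.1⟩

/-- The underlying map `Δⁿ → X` of a singular simplex. -/
def simplexMap (X : LipMet.{u}) {n : SimplexCategoryᵒᵖ} (σ : (singSSet.obj X).obj n) :
    stdSimplex ℝ (Fin (n.unop.len + 1)) → X :=
  fun z => TopCat.toSSetObjEquiv (TopCat.of X) n σ z

/-- A singular simplex `Δⁿ → X` is Lipschitz. The simplex carries the restriction of the sup metric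
of `ℝⁿ⁺¹`; it is bi-Lipschitz equivalent to the Euclidean metric, so the notion is the same. -/
def IsLipschitzSimplex (X : LipMet.{u}) {n : SimplexCategoryᵒᵖ} (σ : (singSSet.obj X).obj n) :
    Prop :=
  ∃ K, LipschitzWith K (simplexMap X σ)

/-- The simplicial subset of the singular Lipschitz simplices. -/
def lipSubcomplex (X : LipMet.{u}) : (singSSet.obj X).Subcomplex where
  obj _ := {σ | IsLipschitzSimplex X σ}
  map {n m} i σ hσ := by
    obtain ⟨K, hK⟩ := hσ
    obtain ⟨L, hL⟩ := lipschitzWith_stdSimplex_map (SimplexCategory.Hom.toOrderHom i.unop)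
    exact ⟨K * L, hK.comp hL⟩

theorem isLipschitzSimplex_map {X Y : LipMet.{u}} (f : X ⟶ Y) {n : SimplexCategoryᵒᵖ}
    (σ : (singSSet.obj X).obj n) (hσ : IsLipschitzSimplex X σ) :
    IsLipschitzSimplex Y ((singSSet.map f).app n σ) := by
  obtain ⟨K, hK⟩ := hσ
  have h := f.locallyLipschitz.comp hK.locallyLipschitz
  have : CompactSpace (stdSimplex ℝ (Fin (n.unop.len + 1))) :=
    isCompact_iff_compactSpace.mp (isCompact_stdSimplex ℝ _)
  obtain ⟨L, hL⟩ := LocallyLipschitzOn.exists_lipschitzOnWith_of_compact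
    isCompact_univ (locallyLipschitzOn_univ.mpr h)
  exact ⟨L, lipschitzOnWith_univ.mp hL⟩

/-- The simplicial set of singular Lipschitz simplices, as a functor. -/
def lipSSet : LipMet.{u} ⥤ SSet.{u} where
  obj X := (lipSubcomplex X).toSSet
  map {X Y} f := Subfunctor.lift ((lipSubcomplex X).ι ≫ singSSet.map f) (by
    rintro n _ ⟨σ, rfl⟩
    exact isLipschitzSimplex_map f σ.1 σ.2)

/-- The inclusion of the singular Lipschitz simplices into the singular simplices. -/
def lipSSetIncl : lipSSet.{u} ⟶ singSSet.{u} where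
  app X := (lipSubcomplex X).ι

/-! ## Chain complexes and homology, with integer coefficients -/

/-- The group `ℤ`, in the universe of the spaces. -/
abbrev intCoeff : AddCommGrpCat.{u} := AddCommGrpCat.of (ULift.{u} ℤ)

/-- The chain complex of a simplicial set with integer coefficients. -/
abbrev chains : SSet.{u} ⥤ ChainComplex AddCommGrpCat.{u} ℕ :=
  (SSet.chainComplexFunctor AddCommGrpCat.{u}).obj intCoeff

/-- The singular chain complex `S_*(X)`. -/
def singChains : LipMet.{u} ⥤ ChainComplex AddCommGrpCat.{u} ℕ := singSSet ⋙ chains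

/-- The singular Lipschitz chain complex `S_*^L(X)`. -/
def lipChains : LipMet.{u} ⥤ ChainComplex AddCommGrpCat.{u} ℕ := lipSSet ⋙ chains

/-- The inclusion `ι : S_*^L → S_*`. -/
def chainsIncl : lipChains.{u} ⟶ singChains.{u} := Functor.whiskerRight lipSSetIncl chains

/-- The singular homology `H_k`. -/
def singHomology (k : ℕ) : LipMet.{u} ⥤ AddCommGrpCat.{u} :=
  singChains ⋙ HomologicalComplex.homologyFunctor _ _ k

/-- The augmentation `∑ a_x x ↦ ∑ a_x` of the chain complex of a simplicial set. -/
def augmentation (K : SSet.{u}) : (chains.obj K).X 0 ⟶ intCoeff.{u} :=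
  Sigma.desc (fun _ => 𝟙 intCoeff)

theorem ι_augmentation (K : SSet.{u}) (x : K.obj (Opposite.op (SimplexCategory.mk 0))) :
    K.ιChainComplex (R := intCoeff) x ≫ augmentation K = 𝟙 _ :=
  Sigma.ι_desc _ _

theorem d_augmentation (K : SSet.{u}) : (chains.obj K).d 1 0 ≫ augmentation K = 0 := by
  refine SSet.chainComplex_hom_ext (fun x => ?_)
  rw [SSet.ιChainComplex_d_assoc]
  simp [Fin.sum_univ_two, ι_augmentation]

theorem map_augmentation {K K' : SSet.{u}} (f : K ⟶ K') :
    (chains.map f).f 0 ≫ augmentation K' = augmentation K := by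
  refine SSet.chainComplex_hom_ext (fun x => ?_)
  rw [SSet.ι_chainComplexMap_f_assoc, ι_augmentation, ι_augmentation]

/-- The augmented chain complex `⋯ → C_1 → C_0 → ℤ → 0` of a simplicial set; the group `ℤ` is in
degree `0` and the group of `k`-chains in degree `k + 1`. -/
def augChains : SSet.{u} ⥤ ChainComplex AddCommGrpCat.{u} ℕ where
  obj K := ChainComplex.augment (chains.obj K) (augmentation K) (d_augmentation K)
  map {K K'} f :=
    { f := fun i => match i with
        | 0 => 𝟙 intCoeff
        | k + 1 => (chains.map f).f k
      comm' := by
        rintro i j (rfl : j + 1 = i)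
        cases j with
        | zero =>
          exact (map_augmentation f).trans (Category.comp_id _).symm
        | succ j => exact (chains.map f).comm (j + 1) j }
  map_id K := by
    ext i : 1
    cases i with
    | zero => rfl
    | succ k => exact congrArg (fun g => HomologicalComplex.Hom.f g k) (chains.map_id K)
  map_comp f g := by
    ext i : 1
    cases i with
    | zero => exact (Category.comp_id _).symm
    | succ k => exact congrArg (fun g => HomologicalComplex.Hom.f g k) (chains.map_comp f g)

/-- The reduced singular Lipschitz homology `H̃_j^L`. -/
def redLipHomology (j : ℕ) : LipMet.{u} ⥤ AddCommGrpCat.{u} :=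
  lipSSet ⋙ augChains ⋙ HomologicalComplex.homologyFunctor _ _ (j + 1)

/-! ## Relative homology -/

/-- The relative chain complex `S_*(X, A) = S_*(X) / S_*(A)` of a functor `S_*` from metric spaces
to chain complexes. -/
def relChains (S : LipMet.{u} ⥤ ChainComplex AddCommGrpCat.{u} ℕ) :
    LipPair.{u} ⥤ ChainComplex AddCommGrpCat.{u} ℕ where
  obj P := cokernel (S.map P.incl)
  map {P Q} f := cokernel.map (S.map P.incl) (S.map Q.incl)
    (S.map (LipPair.Hom.restrict f)) (S.map f.hom)
    (by rw [← S.map_comp, ← S.map_comp, LipPair.restrict_incl])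
  map_id P := by
    rw [← cancel_epi (cokernel.π (S.map P.incl))]
    simp
  map_comp {P Q R} f g := by
    rw [← cancel_epi (cokernel.π (S.map P.incl))]
    simp

/-- A natural transformation of chain complexes induces one of relative chain complexes. -/
def relChainsMap {S T : LipMet.{u} ⥤ ChainComplex AddCommGrpCat.{u} ℕ} (α : S ⟶ T) :
    relChains S ⟶ relChains T where
  app P := cokernel.map (S.map P.incl) (T.map P.incl) (α.app _) (α.app _)
    (α.naturality P.incl)
  naturality P Q f := by
    refine (cancel_epi (cokernel.π (S.map P.incl))).mp ?_
    simp [relChains]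

/-- The singular homology `H_m(X, A)` of pairs. -/
def relSingHomology (m : ℕ) : LipPair.{u} ⥤ AddCommGrpCat.{u} :=
  relChains singChains ⋙ HomologicalComplex.homologyFunctor _ _ m

/-- The singular Lipschitz homology `H_m^L(X, A)` of pairs. -/
def relLipHomology (m : ℕ) : LipPair.{u} ⥤ AddCommGrpCat.{u} :=
  relChains lipChains ⋙ HomologicalComplex.homologyFunctor _ _ m

/-- The natural transformation `ι_* : H_m^L → H_m` induced by the inclusion `S_*^L → S_*`. -/
def inclusionTrans (m : ℕ) : relLipHomology.{u} m ⟶ relSingHomology.{u} m :=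
  Functor.whiskerRight (relChainsMap chainsIncl) (HomologicalComplex.homologyFunctor _ _ m)

/-! ## Local triviality and weak local Lipschitz contractibility -/

/-- `X` is `(H)`-locally trivial: every open neighbourhood `V` of a point contains an open
neighbourhood `U` of that point with `H(U) → H(V)` trivial. -/
def IsLocallyTrivial (H : LipMet.{u} ⥤ AddCommGrpCat.{u}) (X : LipMet.{u}) : Prop :=
  ∀ (x : X) (V : Set X), IsOpen V → x ∈ V →
    ∃ (U : Set X) (h : U ⊆ V), IsOpen U ∧ x ∈ U ∧ H.map (X.subIncl h) = 0

/-- The pairs `(X, A)` such that `X` is `(H̃_j^L)`-locally trivial for `0 ≤ j ≤ m` and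
`(H_k)`-locally trivial for `1 ≤ k ≤ m`, and `A` is `(H̃_p^L)`-locally trivial for
`0 ≤ p ≤ m - 1` and `(H_q)`-locally trivial for `1 ≤ q ≤ m`. -/
def locallyTrivialPairs (m : ℕ) : ObjectProperty LipPair.{u} := fun P =>
  (∀ j, j ≤ m → IsLocallyTrivial (redLipHomology j) P.space) ∧
  (∀ k, 1 ≤ k → k ≤ m → IsLocallyTrivial (singHomology k) P.space) ∧
  (∀ p, p < m → IsLocallyTrivial (redLipHomology p) P.subspace) ∧
  (∀ q, 1 ≤ q → q ≤ m → IsLocallyTrivial (singHomology q) P.subspace)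

/-- `V ⊆ U` is Lipschitz contractible in `U` to `x₀ ∈ U`: there is a Lipschitz homotopy
`h : V × [0, 1] → U` from the inclusion to the constant map with value `x₀`. -/
def IsLipschitzContractibleTo {X : Type u} [MetricSpace X] (V U : Set X) (x₀ : U) : Prop :=
  ∃ (hVU : V ⊆ U) (h : V × unitInterval → U), (∃ K, LipschitzWith K h) ∧
    (∀ v, h (v, 0) = Set.inclusion hVU v) ∧ (∀ v, h (v, 1) = x₀)

/-- Weakly locally Lipschitz contractible metric spaces. -/
def IsWLLC (X : LipMet.{u}) : Prop :=
  ∀ (x : X) (U : Set X), IsOpen U → x ∈ U →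
    ∃ V : Set X, IsOpen V ∧ x ∈ V ∧ V ⊆ U ∧ ∃ x₀ : U, IsLipschitzContractibleTo V U x₀

/-- The pairs `(X, A)` such that `X` and `A` are WLLC. -/
def wllcPairs : ObjectProperty LipPair.{u} := fun P => IsWLLC P.space ∧ IsWLLC P.subspace

end LipHomology

end

/-!
Let `X` be a metric space. The comparison of Lipschitz with singular homology is made by deforming
small singular simplices to Lipschitz chains.

Fix a compact set `K ⊆ X` that contains all simplices of a given chain. Local triviality of the
reduced Lipschitz homology in degree `k` and of the singular homology in degree `k + 1` makes the
quotient of singular by Lipschitz chains locally trivial in degree `k + 1` (`locally_quotBounds`),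
and over `K` this holds for balls of a uniform radius (`Locally.exists_ball`). By induction on the
degree `n` one chooses for every simplex `σ` in `K` of small diameter a chain `h σ` near `σ`, with
`h σ = 0` if `σ` is Lipschitz, such that `σ - h ∂σ - ∂h σ` is a Lipschitz chain near `σ`
(`exists_deformation`). Everything is anchored at the first vertex of `σ`, which lies in `K`, so that
no cover of `X` has to be refined.

Iterated barycentric subdivision makes the simplices of a chain small, and it is homotopic to the
identity by a homotopy that preserves Lipschitz chains. Hence a singular `n`-cycle `c`, which can be
taken to be small, is homologous to the Lipschitz cycle `c - ∂h c` (`exists_sub_d_mem_lip`). If `c`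
is a small singular `(n + 1)`-chain with Lipschitz boundary, then for every simplex `σ` of `c` the
small Lipschitz cycle `∂σ - ∂h ∂σ` bounds a Lipschitz chain, by local triviality of the reduced
Lipschitz homology in degree `n`; as `h ∂c = 0`, the sum of these Lipschitz chains has boundary `∂c`
(`exists_lip_d_eq`). So `H_n^L(X) → H_n(X)` is surjective if the hypotheses hold for `X` up to degree
`n` (up to degree `n - 1` for the Lipschitz homology), and injective if they hold up to degree `n`.
The five lemma for the long exact sequences of a pair gives the first part
(`isIso_inclusionTrans_app`).

For the second part, a Lipschitz contraction of `V` in `U` gives, by the prism operator, that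
`V → U` is trivial on reduced singular and Lipschitz homology
(`SChain.exists_d_eq_map_of_contraction`), so WLLC pairs satisfy all hypotheses of the first part.

Subdivision and prism operators are both obtained from the chains of ordered tuples in a set `E`,
where every chain can be coned off: a natural choice of apexes gives natural chain maps and
homotopies by recursion on the degree (`OChain.sd`, `OChain.homotopy`), and these are transported
along singular simplices by `SChain.natural`.
-/

noncomputable section

namespace LipHomology

/-! ### Free abelian groups -/

namespace Free

variable {α β M : Type*} [AddCommGroup M]

/-- The basis element of the free abelian group `α →₀ ℤ` given by `a`. -/
def gen (a : α) : α →₀ ℤ := Finsupp.single a 1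

/-- The homomorphism on `α →₀ ℤ` with prescribed values on the basis. -/
def lift (f : α → M) : (α →₀ ℤ) →ₗ[ℤ] M := Finsupp.linearCombination ℤ f

@[simp]
theorem lift_gen (f : α → M) (a : α) : lift f (gen a) = f a := by
  simp [lift, gen]

theorem hom_ext {f g : (α →₀ ℤ) →ₗ[ℤ] M} (h : ∀ a, f (gen a) = g (gen a)) : f = g :=
  Finsupp.lhom_ext' fun a => LinearMap.ext_ring (h a)

theorem hom_congr {f g : (α →₀ ℤ) →ₗ[ℤ] M} (h : ∀ a, f (gen a) = g (gen a)) (c : α →₀ ℤ) :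
    f c = g c := by
  rw [hom_ext h]

/-- The subgroup of `α →₀ ℤ` generated by a set of basis elements. -/
def chainsOn (s : Set α) : Submodule ℤ (α →₀ ℤ) := Submodule.span ℤ (gen '' s)

theorem gen_mem_chainsOn {s : Set α} {a : α} (h : a ∈ s) : gen a ∈ chainsOn s :=
  Submodule.subset_span ⟨a, h, rfl⟩

theorem chainsOn_mono {s t : Set α} (h : s ⊆ t) : chainsOn s ≤ chainsOn t :=
  Submodule.span_mono (Set.image_mono h)

theorem map_mem_of_chainsOn {s : Set α} {f : (α →₀ ℤ) →ₗ[ℤ] M} {N : Submodule ℤ M}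
    (h : ∀ a ∈ s, f (gen a) ∈ N) {c : α →₀ ℤ} (hc : c ∈ chainsOn s) : f c ∈ N := by
  have : chainsOn s ≤ N.comap f := Submodule.span_le.2 (by rintro _ ⟨a, ha, rfl⟩; exact h a ha)
  exact this hc

theorem map_eq_of_chainsOn {s : Set α} {f g : (α →₀ ℤ) →ₗ[ℤ] M}
    (h : ∀ a ∈ s, f (gen a) = g (gen a)) {c : α →₀ ℤ} (hc : c ∈ chainsOn s) : f c = g c := by
  have := map_mem_of_chainsOn (f := f - g) (N := ⊥) (s := s) (by simpa [sub_eq_zero] using h) hc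
  simpa [sub_eq_zero] using this

theorem mem_chainsOn_univ (c : α →₀ ℤ) : c ∈ chainsOn (Set.univ : Set α) := by
  induction c using Finsupp.induction_linear with
  | zero => exact zero_mem _
  | add f g hf hg => exact add_mem hf hg
  | single a z =>
    have : Finsupp.single a z = z • gen a := by simp [gen]
    rw [this]
    exact Submodule.smul_mem _ _ (gen_mem_chainsOn trivial)

end Free

open Free

/-! ### Ordered chains of a set -/

/-- The ordered `k`-chains of a set `E`: integral combinations of `(k + 1)`-tuples. -/
abbrev OChain (E : Type*) (k : ℕ) := (Fin (k + 1) → E) →₀ ℤ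

namespace OChain

variable {E E' : Type*}

/-- The boundary of ordered chains. -/
def d (E : Type*) (k : ℕ) : OChain E (k + 1) →ₗ[ℤ] OChain E k :=
  lift fun v => ∑ i : Fin (k + 2), (-1 : ℤ) ^ (i : ℕ) • gen (v ∘ i.succAbove)

/-- The cone over ordered chains with apex `b`. -/
def cone (b : E) (k : ℕ) : OChain E k →ₗ[ℤ] OChain E (k + 1) :=
  lift fun v => gen (Fin.cons b v : Fin (k + 2) → E)

/-- The augmentation of ordered `0`-chains. -/
def aug (E : Type*) : OChain E 0 →ₗ[ℤ] ℤ := lift fun _ => 1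

/-- The map on ordered chains induced by a map of sets. -/
def map (f : E → E') (k : ℕ) : OChain E k →ₗ[ℤ] OChain E' k := lift fun v => gen (f ∘ v)

@[simp]
theorem map_gen (f : E → E') (k : ℕ) (v : Fin (k + 1) → E) : map f k (gen v) = gen (f ∘ v) :=
  lift_gen _ _

theorem d_gen (k : ℕ) (v : Fin (k + 2) → E) :
    d E k (gen v) = ∑ i : Fin (k + 2), (-1 : ℤ) ^ (i : ℕ) • gen (v ∘ i.succAbove) :=
  lift_gen _ _

@[simp]
theorem cone_gen (b : E) (k : ℕ) (v : Fin (k + 1) → E) :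
    cone b k (gen v) = gen (Fin.cons b v : Fin (k + 2) → E) :=
  lift_gen _ _

@[simp]
theorem aug_gen (v : Fin 1 → E) : aug E (gen v) = 1 := lift_gen _ _

theorem d_cone (b : E) (k : ℕ) (c : OChain E (k + 1)) :
    d E (k + 1) (cone b (k + 1) c) = c - cone b k (d E k c) := by
  refine hom_congr (f := d E (k + 1) ∘ₗ cone b (k + 1))
    (g := LinearMap.id - cone b k ∘ₗ d E k) (fun v => ?_) c
  simp only [LinearMap.comp_apply, LinearMap.sub_apply, LinearMap.id_apply, cone_gen, d_gen,
    map_sum, map_smul]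
  rw [Fin.sum_univ_succ, sub_eq_add_neg, ← Finset.sum_neg_distrib]
  congr 1
  · simp [Function.comp_def]
  · refine Finset.sum_congr rfl fun i _ => ?_
    have : (Fin.cons b v : Fin (k + 3) → E) ∘ i.succ.succAbove =
        (Fin.cons b (v ∘ i.succAbove) : Fin (k + 2) → E) := by
      funext j
      refine Fin.cases ?_ (fun j => ?_) j
      · simp
      · simp
    rw [this, Fin.val_succ, pow_succ]
    simp

theorem d_cone_zero (b : E) (c : OChain E 0) :
    d E 0 (cone b 0 c) = c - aug E c • gen (fun _ => b) := by
  refine hom_congr (f := d E 0 ∘ₗ cone b 0)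
    (g := LinearMap.id - (aug E).smulRight (gen (fun _ => b))) (fun v => ?_) c
  simp only [LinearMap.comp_apply, LinearMap.sub_apply, LinearMap.id_apply, cone_gen, d_gen,
    LinearMap.smulRight_apply, aug_gen]
  rw [Fin.sum_univ_two]
  have h0 : (Fin.cons b v : Fin 2 → E) ∘ (0 : Fin 2).succAbove = v := by
    funext j; simp
  have h1 : (Fin.cons b v : Fin 2 → E) ∘ (1 : Fin 2).succAbove = fun _ => b := by
    funext j; fin_cases j; simp
  rw [h0, h1]
  simp [sub_eq_add_neg]

theorem aug_d (c : OChain E 1) : aug E (d E 0 c) = 0 := by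
  refine hom_congr (f := aug E ∘ₗ d E 0) (g := 0) (fun v => ?_) c
  simp [d_gen, Fin.sum_univ_two]

/-- Every tuple is the cone over its tail, so the identity for the boundary of a cone gives
`∂ ∘ ∂ = 0` by induction on the degree. -/
theorem d_d (k : ℕ) (c : OChain E (k + 2)) : d E k (d E (k + 1) c) = 0 := by
  induction k with
  | zero =>
    refine hom_congr (f := d E 0 ∘ₗ d E 1) (g := 0) (fun v => ?_) c
    rw [← Fin.cons_self_tail v, ← cone_gen]
    simp only [LinearMap.comp_apply, d_cone, map_sub, d_cone_zero, aug_d, zero_smul, sub_zero,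
      sub_self, LinearMap.zero_apply]
  | succ k ih =>
    refine hom_congr (f := d E (k + 1) ∘ₗ d E (k + 2)) (g := 0) (fun v => ?_) c
    rw [← Fin.cons_self_tail v, ← cone_gen]
    simp only [LinearMap.comp_apply, d_cone, map_sub, ih, map_zero, sub_zero, sub_self,
      LinearMap.zero_apply]

theorem map_d (f : E → E') (k : ℕ) (c : OChain E (k + 1)) :
    map f k (d E k c) = d E' k (map f (k + 1) c) := by
  refine hom_congr (f := map f k ∘ₗ d E k) (g := d E' k ∘ₗ map f (k + 1)) (fun v => ?_) c
  simp [d_gen, Function.comp_assoc]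

theorem map_cone (f : E → E') (b : E) (k : ℕ) (c : OChain E k) :
    map f (k + 1) (cone b k c) = cone (f b) k (map f k c) := by
  refine hom_congr (f := map f (k + 1) ∘ₗ cone b k) (g := cone (f b) k ∘ₗ map f k)
    (fun v => ?_) c
  simp only [LinearMap.comp_apply, cone_gen, map_gen]
  congr 1
  funext j
  refine Fin.cases ?_ (fun j => ?_) j <;> simp

theorem aug_map (f : E → E') (c : OChain E 0) : aug E' (map f 0 c) = aug E c := by
  refine hom_congr (f := aug E' ∘ₗ map f 0) (g := aug E) (fun v => ?_) c
  simp

/-! ### Subdivision of ordered chains, and homotopies -/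

/-- The subdivision of ordered chains with respect to a choice `β` of an apex for every tuple: a
tuple is replaced by the cone with apex `β v` over the subdivision of its boundary. No property of
`β` is needed for this to be a chain map; barycentric subdivision is the case of barycentres. -/
def sd (β : ∀ k, (Fin (k + 1) → E) → E) : ∀ k, OChain E k →ₗ[ℤ] OChain E k
  | 0 => LinearMap.id
  | k + 1 => lift fun v => cone (β _ v) k (sd β k (d E k (gen v)))

theorem sd_succ_gen (β : ∀ k, (Fin (k + 1) → E) → E) (k : ℕ) (v : Fin (k + 2) → E) :
    sd β (k + 1) (gen v) = cone (β _ v) k (sd β k (d E k (gen v))) :=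
  lift_gen _ _

theorem d_sd (β : ∀ k, (Fin (k + 1) → E) → E) (k : ℕ) (c : OChain E (k + 1)) :
    d E k (sd β (k + 1) c) = sd β k (d E k c) := by
  induction k with
  | zero =>
    refine hom_congr (f := d E 0 ∘ₗ sd β 1) (g := sd β 0 ∘ₗ d E 0) (fun v => ?_) c
    simp only [LinearMap.comp_apply, sd_succ_gen, d_cone_zero]
    simp [sd, aug_d]
  | succ k ih =>
    refine hom_congr (f := d E (k + 1) ∘ₗ sd β (k + 2)) (g := sd β (k + 1) ∘ₗ d E (k + 1))
      (fun v => ?_) c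
    simp only [LinearMap.comp_apply]
    rw [sd_succ_gen β (k + 1) v, d_cone, ih, d_d]
    simp

/-- Subdivision is natural for maps that preserve the chosen apexes. -/
theorem map_sd {β : ∀ k, (Fin (k + 1) → E) → E} {β' : ∀ k, (Fin (k + 1) → E') → E'} {f : E → E'}
    (hf : ∀ k v, f (β k v) = β' k (f ∘ v)) (k : ℕ) (c : OChain E k) :
    map f k (sd β k c) = sd β' k (map f k c) := by
  induction k with
  | zero => rfl
  | succ k ih =>
    refine hom_congr (f := map f (k + 1) ∘ₗ sd β (k + 1)) (g := sd β' (k + 1) ∘ₗ map f (k + 1))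
      (fun v => ?_) c
    simp only [LinearMap.comp_apply, sd_succ_gen, map_cone, ih, map_d, hf, map_gen]

/-- The `N`-fold iterate of the subdivision. -/
def sdIter (β : ∀ k, (Fin (k + 1) → E) → E) (N k : ℕ) : OChain E k →ₗ[ℤ] OChain E k :=
  (sd β k) ^ N

theorem sdIter_succ (β : ∀ k, (Fin (k + 1) → E) → E) (N k : ℕ) (c : OChain E k) :
    sdIter β (N + 1) k c = sd β k (sdIter β N k c) := by
  rw [sdIter, pow_succ']; rfl

theorem d_sdIter (β : ∀ k, (Fin (k + 1) → E) → E) (N k : ℕ) (c : OChain E (k + 1)) :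
    d E k (sdIter β N (k + 1) c) = sdIter β N k (d E k c) := by
  induction N with
  | zero => rfl
  | succ N ih => rw [sdIter_succ, sdIter_succ, d_sd, ih]

theorem map_sdIter {β : ∀ k, (Fin (k + 1) → E) → E} {β' : ∀ k, (Fin (k + 1) → E') → E'}
    {f : E → E'} (hf : ∀ k v, f (β k v) = β' k (f ∘ v)) (N k : ℕ) (c : OChain E k) :
    map f k (sdIter β N k c) = sdIter β' N k (map f k c) := by
  induction N with
  | zero => rfl
  | succ N ih => rw [sdIter_succ, sdIter_succ, map_sd hf, ih]

theorem sdIter_zero_right (β : ∀ k, (Fin (k + 1) → E) → E) (N : ℕ) (c : OChain E 0) :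
    sdIter β N 0 c = c := by
  induction N with
  | zero => rfl
  | succ N ih => rw [sdIter_succ, ih]; rfl

/-- A homotopy between two chain maps `F` and `G` of ordered chains, built by coning off the cycle
`G v - F v - P ∂v` from the apex `β v`. -/
def homotopy (F G : ∀ k, OChain E k →ₗ[ℤ] OChain E' k) (β : ∀ k, (Fin (k + 1) → E) → E') :
    ∀ k, OChain E k →ₗ[ℤ] OChain E' (k + 1)
  | 0 => lift fun v => cone (β _ v) 0 (G 0 (gen v) - F 0 (gen v))
  | k + 1 => lift fun v => cone (β _ v) (k + 1)
      (G (k + 1) (gen v) - F (k + 1) (gen v) - homotopy F G β k (d E k (gen v)))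

section Homotopy

variable {F G : ∀ k, OChain E k →ₗ[ℤ] OChain E' k} {β : ∀ k, (Fin (k + 1) → E) → E'}

theorem homotopy_zero_gen (v : Fin 1 → E) :
    homotopy F G β 0 (gen v) = cone (β _ v) 0 (G 0 (gen v) - F 0 (gen v)) :=
  lift_gen _ _

theorem homotopy_succ_gen (k : ℕ) (v : Fin (k + 2) → E) :
    homotopy F G β (k + 1) (gen v) = cone (β _ v) (k + 1)
      (G (k + 1) (gen v) - F (k + 1) (gen v) - homotopy F G β k (d E k (gen v))) :=
  lift_gen _ _

theorem d_homotopy_zero (haug : ∀ c, aug E' (F 0 c) = aug E' (G 0 c)) (c : OChain E 0) :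
    d E' 0 (homotopy F G β 0 c) = G 0 c - F 0 c := by
  refine hom_congr (f := d E' 0 ∘ₗ homotopy F G β 0) (g := G 0 - F 0) (fun v => ?_) c
  simp only [LinearMap.comp_apply, LinearMap.sub_apply, homotopy_zero_gen, d_cone_zero]
  rw [map_sub (aug E'), haug, sub_self, zero_smul, sub_zero]

theorem d_homotopy_succ (haug : ∀ c, aug E' (F 0 c) = aug E' (G 0 c))
    (hF : ∀ k c, d E' k (F (k + 1) c) = F k (d E k c))
    (hG : ∀ k c, d E' k (G (k + 1) c) = G k (d E k c)) (k : ℕ) (c : OChain E (k + 1)) :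
    d E' (k + 1) (homotopy F G β (k + 1) c) =
      G (k + 1) c - F (k + 1) c - homotopy F G β k (d E k c) := by
  induction k with
  | zero =>
    refine hom_congr (f := d E' 1 ∘ₗ homotopy F G β 1)
      (g := G 1 - F 1 - homotopy F G β 0 ∘ₗ d E 0) (fun v => ?_) c
    simp only [LinearMap.comp_apply, LinearMap.sub_apply]
    rw [homotopy_succ_gen, d_cone, map_sub (d E' 0), map_sub (d E' 0), d_homotopy_zero haug, hF, hG]
    simp
  | succ k ih =>
    refine hom_congr (f := d E' (k + 2) ∘ₗ homotopy F G β (k + 2))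
      (g := G (k + 2) - F (k + 2) - homotopy F G β (k + 1) ∘ₗ d E (k + 1)) (fun v => ?_) c
    simp only [LinearMap.comp_apply, LinearMap.sub_apply]
    rw [homotopy_succ_gen (k + 1), d_cone, map_sub (d E' (k + 1)), map_sub (d E' (k + 1)), ih, d_d,
      hF, hG]
    simp

end Homotopy

/-- The homotopy is natural for maps that preserve the chosen apexes and commute with the two chain
maps. -/
theorem map_homotopy {E₁ E₁' : Type*} {F G : ∀ k, OChain E k →ₗ[ℤ] OChain E' k}
    {β : ∀ k, (Fin (k + 1) → E) → E'}
    {F₁ G₁ : ∀ k, OChain E₁ k →ₗ[ℤ] OChain E₁' k} {β₁ : ∀ k, (Fin (k + 1) → E₁) → E₁'}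
    {f : E → E₁} {g : E' → E₁'}
    (hβ : ∀ k v, g (β k v) = β₁ k (f ∘ v))
    (hF : ∀ k c, map g k (F k c) = F₁ k (map f k c))
    (hG : ∀ k c, map g k (G k c) = G₁ k (map f k c)) (k : ℕ) (c : OChain E k) :
    map g (k + 1) (homotopy F G β k c) = homotopy F₁ G₁ β₁ k (map f k c) := by
  induction k with
  | zero =>
    refine hom_congr (f := map g 1 ∘ₗ homotopy F G β 0) (g := homotopy F₁ G₁ β₁ 0 ∘ₗ map f 0)
      (fun v => ?_) c
    simp only [LinearMap.comp_apply, map_gen, homotopy_zero_gen, map_cone, hβ]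
    rw [map_sub, hF, hG, map_gen]
  | succ k ih =>
    refine hom_congr (f := map g (k + 2) ∘ₗ homotopy F G β (k + 1))
      (g := homotopy F₁ G₁ β₁ (k + 1) ∘ₗ map f (k + 1)) (fun v => ?_) c
    simp only [LinearMap.comp_apply, map_gen, homotopy_succ_gen, map_cone, hβ]
    rw [map_sub (map g (k + 1)), map_sub (map g (k + 1)), hF, hG, map_gen, ih, map_d, map_gen]

end OChain

/-! ### Affine maps between standard simplices -/

/-- The standard topological simplex of dimension `n`. -/
abbrev Simplex (n : ℕ) := stdSimplex ℝ (Fin (n + 1))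

/-- The affine map `Δʲ → Δⁿ` with prescribed values `w` at the vertices. -/
def aff {j n : ℕ} (w : Fin (j + 1) → Simplex n) (t : Simplex j) : Simplex n :=
  ⟨∑ i, t.1 i • (w i).1, (convex_stdSimplex ℝ _).sum_mem (fun i _ => t.2.1 i) t.2.2
    (fun i _ => (w i).2)⟩

/-- The tuple of the vertices of `Δⁿ`. -/
def vertices (n : ℕ) : Fin (n + 1) → Simplex n := fun i => stdSimplex.vertex i

theorem aff_apply {j n : ℕ} (w : Fin (j + 1) → Simplex n) (t : Simplex j) (a : Fin (n + 1)) :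
    (aff w t).1 a = ∑ i, t.1 i * (w i).1 a := by
  simp [aff]

@[simp]
theorem aff_vertex {j n : ℕ} (w : Fin (j + 1) → Simplex n) (i : Fin (j + 1)) :
    aff w (vertices j i) = w i := by
  refine Subtype.ext (funext fun a => ?_)
  simp [aff_apply, vertices, Pi.single_apply]

@[simp]
theorem aff_vertices {n : ℕ} (t : Simplex n) : aff (vertices n) t = t := by
  refine Subtype.ext (funext fun a => ?_)
  simp [aff_apply, vertices, Pi.single_apply]

/-- Affine maps compose by applying the outer map to the vertices of the inner one. -/
theorem aff_aff {i j n : ℕ} (w : Fin (j + 1) → Simplex n) (v : Fin (i + 1) → Simplex j)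
    (t : Simplex i) : aff w (aff v t) = aff (aff w ∘ v) t := by
  refine Subtype.ext (funext fun a => ?_)
  simp only [aff_apply, Function.comp, Finset.sum_mul, Finset.mul_sum]
  rw [Finset.sum_comm]
  simp only [mul_assoc]

theorem map_eq_aff {j n : ℕ} (φ : Fin (j + 1) → Fin (n + 1)) (t : Simplex j) :
    stdSimplex.map φ t = aff (vertices n ∘ φ) t := by
  refine Subtype.ext (funext fun a => ?_)
  rw [aff_apply]
  change FunOnFinite.linearMap ℝ ℝ φ t.1 a = _
  rw [FunOnFinite.linearMap_apply_apply]
  simp [vertices, Pi.single_apply, Finset.sum_filter, eq_comm]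

theorem aff_map {i j n : ℕ} (w : Fin (j + 1) → Simplex n) (φ : Fin (i + 1) → Fin (j + 1))
    (t : Simplex i) : aff w (stdSimplex.map φ t) = aff (w ∘ φ) t := by
  rw [map_eq_aff, aff_aff]
  congr 1
  funext a
  simp

theorem dist_aff_le {j n : ℕ} {w : Fin (j + 1) → Simplex n} {p : Simplex n} {R : ℝ}
    (h : ∀ i, dist (w i) p ≤ R) (t : Simplex j) : dist (aff w t) p ≤ R := by
  have : (aff w t).1 ∈ Metric.closedBall p.1 R :=
    (convex_closedBall p.1 R).sum_mem (fun i _ => t.2.1 i) t.2.2 (fun i _ => h i)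
  exact this

theorem dist_aff_aff_le {j n : ℕ} {w : Fin (j + 1) → Simplex n} {R : ℝ}
    (h : ∀ i i', dist (w i) (w i') ≤ R) (s t : Simplex j) : dist (aff w s) (aff w t) ≤ R := by
  refine dist_aff_le (fun i => ?_) s
  rw [dist_comm]
  exact dist_aff_le (fun i' => h i' i) t

theorem dist_simplex_le_one {n : ℕ} (s t : Simplex n) : dist s t ≤ 1 :=
  (Metric.dist_le_diam_of_mem (bounded_stdSimplex _) s.2 t.2).trans diam_stdSimplex_le

theorem lipschitzWith_aff {j n : ℕ} (w : Fin (j + 1) → Simplex n) :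
    LipschitzWith (j + 1) (aff w) := by
  refine LipschitzWith.of_dist_le_mul fun s t => ?_
  refine (dist_pi_le_iff (by positivity)).2 fun a => ?_
  rw [Real.dist_eq, aff_apply, aff_apply, ← Finset.sum_sub_distrib]
  refine (Finset.abs_sum_le_sum_abs _ _).trans ?_
  have : ∀ i ∈ Finset.univ, |s.1 i * (w i).1 a - t.1 i * (w i).1 a| ≤ dist s t := by
    intro i _
    rw [← sub_mul, abs_mul, abs_of_nonneg ((w i).2.1 a)]
    have h1 : |s.1 i - t.1 i| ≤ dist s t := dist_le_pi_dist s.1 t.1 i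
    have h2 : (w i).1 a ≤ 1 := stdSimplex.le_one (w i) a
    exact (mul_le_mul h1 h2 ((w i).2.1 a) dist_nonneg).trans (by simp)
  refine (Finset.sum_le_sum this).trans ?_
  simp

/-- The barycentre of a tuple of points of `Δⁿ`. -/
def bary {n : ℕ} (k : ℕ) (v : Fin (k + 1) → Simplex n) : Simplex n := aff v stdSimplex.barycenter

theorem aff_bary {n m : ℕ} (w : Fin (n + 1) → Simplex m) (k : ℕ) (v : Fin (k + 1) → Simplex n) :
    aff w (bary k v) = bary k (aff w ∘ v) :=
  aff_aff _ _ _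

/-- The vector `v i - bary v` is the mean of the `k + 1` vectors `v i - v j`, one of which vanishes;
this gives the contraction factor of barycentric subdivision. -/
theorem dist_bary_le {n k : ℕ} {v : Fin (k + 1) → Simplex n} {r : ℝ}
    (h : ∀ i j, dist (v i) (v j) ≤ r) (i : Fin (k + 1)) :
    dist (v i) (bary k v) ≤ k / (k + 1) * r := by
  have hr : 0 ≤ r := dist_nonneg.trans (h i i)
  refine (dist_pi_le_iff (by positivity)).2 fun a => ?_
  have hb : (v i).1 a - (bary k v).1 a =
      (k + 1 : ℝ)⁻¹ * ∑ j, ((v i).1 a - (v j).1 a) := by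
    simp only [bary, aff_apply, Finset.sum_sub_distrib, stdSimplex.barycenter_apply,
      ← Finset.mul_sum, Finset.sum_const, Finset.card_univ, Fintype.card_fin, nsmul_eq_mul]
    push_cast
    field_simp
  rw [Real.dist_eq, hb, abs_mul, abs_of_nonneg (by positivity), div_eq_inv_mul, mul_assoc]
  refine mul_le_mul_of_nonneg_left ?_ (by positivity)
  refine (Finset.abs_sum_le_sum_abs _ _).trans ?_
  rw [Fin.sum_univ_succAbove _ i]
  have : ∀ j ∈ Finset.univ, |(v i).1 a - (v (i.succAbove j)).1 a| ≤ r := fun j _ =>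
    (dist_le_pi_dist (v i).1 (v (i.succAbove j)).1 a).trans (h i (i.succAbove j))
  have h2 := Finset.sum_le_sum this
  simp only [sub_self, abs_zero, zero_add]
  refine h2.trans ?_
  simp

/-! ### The mesh of the barycentric subdivision -/

/-- The tuples in the subdivision of `v` lie in every ball that contains `v`, and their diameter is
smaller than that of `v` by the factor `k / (k + 1)`. The statement on balls replaces the convex hull
of `v`, and is what bounds the distance from the apex to the subdivided boundary. -/
theorem sd_gen_mem_chainsOn {n : ℕ} (k : ℕ) (v : Fin (k + 1) → Simplex n) :
    OChain.sd bary k (gen v) ∈ chainsOn {w : Fin (k + 1) → Simplex n |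
      (∀ p R, (∀ i, dist (v i) p ≤ R) → ∀ i, dist (w i) p ≤ R) ∧
      ∀ r, (∀ i j, dist (v i) (v j) ≤ r) → ∀ i j, dist (w i) (w j) ≤ k / (k + 1) * r} := by
  induction k with
  | zero =>
    refine gen_mem_chainsOn ⟨fun _ _ h => h, fun r _ i j => ?_⟩
    have hij : i = j := Subsingleton.elim (α := Fin 1) i j
    simp [hij]
  | succ k ih =>
    rw [OChain.sd_succ_gen, OChain.d_gen, map_sum, map_sum]
    refine sum_mem fun a _ => ?_
    rw [map_smul, map_smul]
    refine Submodule.smul_mem _ _ (map_mem_of_chainsOn (fun w hw => ?_) (ih (v ∘ a.succAbove)))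
    obtain ⟨hA, hB⟩ := hw
    rw [OChain.cone_gen]
    refine gen_mem_chainsOn ⟨fun p R h => ?_, fun r h => ?_⟩
    · refine Fin.cases ?_ fun i => ?_
      · exact dist_aff_le h _
      · simpa using hA p R (fun i => h _) i
    · have hr : 0 ≤ r := dist_nonneg.trans (h 0 0)
      have hw : ∀ i, dist (w i) (bary (k + 1) v) ≤ (k + 1 : ℕ) / ((k + 1 : ℕ) + 1) * r :=
        hA _ _ fun i => dist_bary_le h _
      have hww : ∀ i j, dist (w i) (w j) ≤ (k + 1 : ℕ) / ((k + 1 : ℕ) + 1) * r := fun i j => by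
        refine (hB r (fun i j => h _ _) i j).trans (mul_le_mul_of_nonneg_right ?_ hr)
        rw [div_le_div_iff₀ (by positivity) (by positivity)]
        push_cast
        nlinarith
      refine Fin.cases (Fin.cases ?_ fun j => ?_) fun i => Fin.cases ?_ fun j => ?_
      · simpa using mul_nonneg (by positivity) hr
      · simpa [dist_comm] using hw j
      · simpa using hw i
      · simpa using hww i j

theorem sdIter_gen_mem_chainsOn {n : ℕ} (N k : ℕ) (v : Fin (k + 1) → Simplex n) :
    OChain.sdIter bary N k (gen v) ∈ chainsOn {w : Fin (k + 1) → Simplex n |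
      ∀ i j, dist (w i) (w j) ≤ (k / (k + 1) : ℝ) ^ N} := by
  induction N with
  | zero => exact gen_mem_chainsOn fun i j => by simpa using dist_simplex_le_one _ _
  | succ N ih =>
    rw [OChain.sdIter_succ]
    refine map_mem_of_chainsOn (fun w hw => ?_) ih
    refine chainsOn_mono (fun w' hw' => ?_) (sd_gen_mem_chainsOn k w)
    rw [Set.mem_ofPred_eq, pow_succ']
    exact hw'.2 _ hw

/-! ### Singular chains -/

/-- The inclusion of the face of `Δᵏ⁺¹` opposite to the vertex `i`. -/
def faceMap {k : ℕ} (i : Fin (k + 2)) : C(Simplex k, Simplex (k + 1)) :=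
  ⟨stdSimplex.map i.succAbove, stdSimplex.continuous_map _⟩

/-- An affine map of simplices, as a continuous map. -/
def affC {j n : ℕ} (w : Fin (j + 1) → Simplex n) : C(Simplex j, Simplex n) :=
  ⟨aff w, (lipschitzWith_aff w).continuous⟩

theorem affC_comp_faceMap {j n : ℕ} (w : Fin (j + 2) → Simplex n) (i : Fin (j + 2)) :
    (affC w).comp (faceMap i) = affC (w ∘ i.succAbove) :=
  ContinuousMap.ext fun t => aff_map w i.succAbove t

theorem affC_comp_affC {i j n : ℕ} (w : Fin (j + 1) → Simplex n) (v : Fin (i + 1) → Simplex j) :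
    (affC w).comp (affC v) = affC (aff w ∘ v) :=
  ContinuousMap.ext fun t => aff_aff w v t

theorem affC_vertices (n : ℕ) : affC (vertices n) = ContinuousMap.id _ :=
  ContinuousMap.ext fun t => aff_vertices t

theorem faceMap_eq_affC {k : ℕ} (i : Fin (k + 2)) :
    faceMap i = affC (vertices (k + 1) ∘ i.succAbove) :=
  ContinuousMap.ext fun t => map_eq_aff i.succAbove t

/-- The singular `k`-chains of a space. -/
abbrev SChain (X : Type*) [TopologicalSpace X] (k : ℕ) := C(Simplex k, X) →₀ ℤ

namespace SChain

variable {X Y : Type*} [TopologicalSpace X] [TopologicalSpace Y]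

/-- The boundary of singular chains. -/
def d (X : Type*) [TopologicalSpace X] (k : ℕ) : SChain X (k + 1) →ₗ[ℤ] SChain X k :=
  lift fun σ => ∑ i : Fin (k + 2), (-1 : ℤ) ^ (i : ℕ) • gen (σ.comp (faceMap i))

theorem d_gen (k : ℕ) (σ : C(Simplex (k + 1), X)) :
    d X k (gen σ) = ∑ i : Fin (k + 2), (-1 : ℤ) ^ (i : ℕ) • gen (σ.comp (faceMap i)) :=
  lift_gen _ _

/-- The augmentation of singular `0`-chains. -/
def aug (X : Type*) [TopologicalSpace X] : SChain X 0 →ₗ[ℤ] ℤ := lift fun _ => 1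

@[simp]
theorem aug_gen (σ : C(Simplex 0, X)) : aug X (gen σ) = 1 := lift_gen _ _

theorem aug_d (c : SChain X 1) : aug X (d X 0 c) = 0 := by
  refine hom_congr (f := aug X ∘ₗ d X 0) (g := 0) (fun v => ?_) c
  simp [d_gen, Fin.sum_univ_two]

/-- The map on singular chains induced by a continuous map. -/
def map (f : C(X, Y)) (k : ℕ) : SChain X k →ₗ[ℤ] SChain Y k := lift fun σ => gen (f.comp σ)

@[simp]
theorem map_gen (f : C(X, Y)) (k : ℕ) (σ : C(Simplex k, X)) :
    map f k (gen σ) = gen (f.comp σ) :=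
  lift_gen _ _

theorem map_d (f : C(X, Y)) (k : ℕ) (c : SChain X (k + 1)) :
    map f k (d X k c) = d Y k (map f (k + 1) c) := by
  refine hom_congr (f := map f k ∘ₗ d X k) (g := d Y k ∘ₗ map f (k + 1)) (fun σ => ?_) c
  simp [d_gen, ContinuousMap.comp_assoc]

theorem aug_map (f : C(X, Y)) (c : SChain X 0) : aug Y (map f 0 c) = aug X c := by
  refine hom_congr (f := aug Y ∘ₗ map f 0) (g := aug X) (fun v => ?_) c
  simp

/-- Ordered chains of a set `E` give singular chains when every tuple of points of `E` spans a
singular simplex, compatibly with faces. -/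
def realize {E : Type*} (ρ : ∀ j, (Fin (j + 1) → E) → C(Simplex j, X)) (j : ℕ) :
    OChain E j →ₗ[ℤ] SChain X j :=
  lift fun w => gen (ρ j w)

@[simp]
theorem realize_gen {E : Type*} (ρ : ∀ j, (Fin (j + 1) → E) → C(Simplex j, X)) (j : ℕ)
    (w : Fin (j + 1) → E) : realize ρ j (gen w) = gen (ρ j w) :=
  lift_gen _ _

theorem d_realize {E : Type*} {ρ : ∀ j, (Fin (j + 1) → E) → C(Simplex j, X)}
    (hρ : ∀ j w i, (ρ (j + 1) w).comp (faceMap i) = ρ j (w ∘ i.succAbove)) (j : ℕ)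
    (c : OChain E (j + 1)) : d X j (realize ρ (j + 1) c) = realize ρ j (OChain.d E j c) := by
  refine hom_congr (f := d X j ∘ₗ realize ρ (j + 1)) (g := realize ρ j ∘ₗ OChain.d E j)
    (fun w => ?_) c
  simp [d_gen, OChain.d_gen, hρ]

/-- The image under a singular simplex `σ : Δⁿ → X` of the ordered chains of `Δⁿ`. -/
def push {n : ℕ} (σ : C(Simplex n, X)) (j : ℕ) : OChain (Simplex n) j →ₗ[ℤ] SChain X j :=
  realize (fun _ w => σ.comp (affC w)) j

@[simp]
theorem push_gen {n : ℕ} (σ : C(Simplex n, X)) (j : ℕ) (w : Fin (j + 1) → Simplex n) :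
    push σ j (gen w) = gen (σ.comp (affC w)) :=
  realize_gen _ _ _

theorem d_push {n : ℕ} (σ : C(Simplex n, X)) (j : ℕ) (c : OChain (Simplex n) (j + 1)) :
    d X j (push σ (j + 1) c) = push σ j (OChain.d _ j c) :=
  d_realize (fun j w i => by rw [ContinuousMap.comp_assoc, affC_comp_faceMap]) j c

theorem push_vertices {n : ℕ} (σ : C(Simplex n, X)) : push σ n (gen (vertices n)) = gen σ := by
  rw [push_gen, affC_vertices, ContinuousMap.comp_id]

/-- A singular simplex is the image of the tuple of vertices of `Δⁿ`, so `∂ ∘ ∂ = 0` is inherited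
from ordered chains. -/
theorem d_d (k : ℕ) (c : SChain X (k + 2)) : d X k (d X (k + 1) c) = 0 := by
  refine hom_congr (f := d X k ∘ₗ d X (k + 1)) (g := 0) (fun σ => ?_) c
  rw [LinearMap.comp_apply, ← push_vertices, d_push, d_push, OChain.d_d]
  simp

/-- The operator on singular chains given by a natural operator `D` from the ordered chains of the
simplices `Δⁿ` to those of sets `E n` that are realized by `R σ` along singular simplices `σ`: the
operator `D` is applied to the tuple of vertices, and the result is realized along `σ`. -/
def natural {s : ℕ} {E : ℕ → Type*} (D : ∀ n j, OChain (Simplex n) j →ₗ[ℤ] OChain (E n) (j + s))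
    (R : ∀ {n : ℕ}, C(Simplex n, X) → ∀ j, OChain (E n) j →ₗ[ℤ] SChain Y j) (k : ℕ) :
    SChain X k →ₗ[ℤ] SChain Y (k + s) :=
  lift fun σ => R σ (k + s) (D k k (gen (vertices k)))

theorem natural_gen {s : ℕ} {E : ℕ → Type*}
    (D : ∀ n j, OChain (Simplex n) j →ₗ[ℤ] OChain (E n) (j + s))
    (R : ∀ {n : ℕ}, C(Simplex n, X) → ∀ j, OChain (E n) j →ₗ[ℤ] SChain Y j) (k : ℕ)
    (σ : C(Simplex k, X)) : natural D R k (gen σ) = R σ (k + s) (D k k (gen (vertices k))) :=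
  lift_gen _ _

/-- If `D` and `R` are natural for affine maps, then the operator commutes with the images under
singular simplices; this reduces identities between such operators to ordered chains. -/
theorem natural_push {s : ℕ} {E : ℕ → Type*}
    {D : ∀ n j, OChain (Simplex n) j →ₗ[ℤ] OChain (E n) (j + s)}
    {R : ∀ {n : ℕ}, C(Simplex n, X) → ∀ j, OChain (E n) j →ₗ[ℤ] SChain Y j}
    (act : ∀ {n m : ℕ}, (Fin (n + 1) → Simplex m) → E n → E m)
    (hD : ∀ {n m : ℕ} (w : Fin (n + 1) → Simplex m) (j : ℕ) (c : OChain (Simplex n) j),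
      OChain.map (act w) (j + s) (D n j c) = D m j (OChain.map (aff w) j c))
    (hR : ∀ {n m : ℕ} (σ : C(Simplex m, X)) (w : Fin (n + 1) → Simplex m) (j : ℕ)
      (c : OChain (E n) j), R (σ.comp (affC w)) j c = R σ j (OChain.map (act w) j c))
    {n : ℕ} (σ : C(Simplex n, X)) (k : ℕ) (c : OChain (Simplex n) k) :
    natural D R k (push σ k c) = R σ (k + s) (D n k c) := by
  refine hom_congr (f := natural D R k ∘ₗ push σ k) (g := R σ (k + s) ∘ₗ D n k) (fun w => ?_) c
  simp only [LinearMap.comp_apply, push_gen, natural_gen, hR, hD, OChain.map_gen]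
  congr 3
  funext i
  simp

theorem push_comp_affC {n m : ℕ} (σ : C(Simplex m, X)) (w : Fin (n + 1) → Simplex m) (j : ℕ)
    (c : OChain (Simplex n) j) : push (σ.comp (affC w)) j c = push σ j (OChain.map (aff w) j c) := by
  refine hom_congr (f := push (σ.comp (affC w)) j) (g := push σ j ∘ₗ OChain.map (aff w) j)
    (fun v => ?_) c
  simp [ContinuousMap.comp_assoc, affC_comp_affC]

/-! ### Subdivision of singular chains -/

/-- The `N`-fold barycentric subdivision of singular chains. -/
def subdiv (X : Type*) [TopologicalSpace X] (N k : ℕ) : SChain X k →ₗ[ℤ] SChain X k :=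
  natural (s := 0) (fun _ j => OChain.sdIter bary N j) push k

/-- The homotopy between the subdivision of ordered chains of `Δⁿ` and the identity. -/
def sdHomotopy (N n j : ℕ) : OChain (Simplex n) j →ₗ[ℤ] OChain (Simplex n) (j + 1) :=
  OChain.homotopy (fun j => OChain.sdIter bary N j) (fun _ => LinearMap.id) bary j

/-- The homotopy between the subdivision of singular chains and the identity. -/
def subdivHomotopy (X : Type*) [TopologicalSpace X] (N k : ℕ) :
    SChain X k →ₗ[ℤ] SChain X (k + 1) :=
  natural (s := 1) (sdHomotopy N) push k

theorem subdiv_gen (N k : ℕ) (σ : C(Simplex k, X)) :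
    subdiv X N k (gen σ) = push σ k (OChain.sdIter bary N k (gen (vertices k))) :=
  natural_gen _ _ _ _

theorem subdiv_push (N : ℕ) {n : ℕ} (σ : C(Simplex n, X)) (k : ℕ) (c : OChain (Simplex n) k) :
    subdiv X N k (push σ k c) = push σ k (OChain.sdIter bary N k c) :=
  natural_push (s := 0) (fun w => aff w)
    (fun w _ c => OChain.map_sdIter (fun k v => aff_bary w k v) N _ c) push_comp_affC σ k c

theorem subdivHomotopy_push (N : ℕ) {n : ℕ} (σ : C(Simplex n, X)) (k : ℕ)
    (c : OChain (Simplex n) k) :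
    subdivHomotopy X N k (push σ k c) = push σ (k + 1) (sdHomotopy N n k c) :=
  natural_push (s := 1) (fun w => aff w)
    (fun w _ c => OChain.map_homotopy (fun k v => aff_bary w k v)
      (fun _ c => OChain.map_sdIter (fun k v => aff_bary w k v) N _ c) (fun _ _ => rfl) _ c)
    push_comp_affC σ k c

theorem d_subdiv (N k : ℕ) (c : SChain X (k + 1)) :
    d X k (subdiv X N (k + 1) c) = subdiv X N k (d X k c) := by
  refine hom_congr (f := d X k ∘ₗ subdiv X N (k + 1)) (g := subdiv X N k ∘ₗ d X k) (fun σ => ?_) c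
  simp only [LinearMap.comp_apply]
  rw [← push_vertices, subdiv_push, d_push, d_push, subdiv_push, OChain.d_sdIter]

theorem subdiv_zero_right (N : ℕ) (c : SChain X 0) : subdiv X N 0 c = c := by
  refine hom_congr (f := subdiv X N 0) (g := LinearMap.id) (fun σ => ?_) c
  rw [subdiv_gen, OChain.sdIter_zero_right, push_vertices, LinearMap.id_apply]

theorem d_subdivHomotopy (N k : ℕ) (c : SChain X (k + 1)) :
    d X (k + 1) (subdivHomotopy X N (k + 1) c) =
      c - subdiv X N (k + 1) c - subdivHomotopy X N k (d X k c) := by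
  refine hom_congr (f := d X (k + 1) ∘ₗ subdivHomotopy X N (k + 1))
    (g := LinearMap.id - subdiv X N (k + 1) - subdivHomotopy X N k ∘ₗ d X k) (fun σ => ?_) c
  simp only [LinearMap.comp_apply, LinearMap.sub_apply, LinearMap.id_apply]
  rw [← push_vertices, subdivHomotopy_push, d_push, d_push, subdiv_push, subdivHomotopy_push,
    sdHomotopy, OChain.d_homotopy_succ (fun c => by rw [OChain.sdIter_zero_right]; rfl)
      (OChain.d_sdIter bary N) (fun _ _ => rfl)]
  simp [sdHomotopy]

end SChain

open Metric

/-! ### Lipschitz simplices and simplices in a subset -/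

section Sets

variable {X Y : Type*}

/-- The singular `k`-simplices with image in `U`. -/
def inSet [TopologicalSpace X] (U : Set X) (k : ℕ) : Set C(Simplex k, X) :=
  {σ | ∀ t, σ t ∈ U}

/-- The singular Lipschitz `k`-simplices. -/
def lip (X : Type*) [MetricSpace X] (k : ℕ) : Set C(Simplex k, X) :=
  {σ | ∃ K, LipschitzWith K σ}

/-- The singular Lipschitz `k`-simplices with image in `U`. -/
def lipIn [MetricSpace X] (U : Set X) (k : ℕ) : Set C(Simplex k, X) := inSet U k ∩ lip X k

/-- The singular `k`-simplices with image in `K` and of diameter smaller than `δ`. -/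
def small [MetricSpace X] (K : Set X) (δ : ℝ) (k : ℕ) : Set C(Simplex k, X) :=
  {σ | σ ∈ inSet K k ∧ ∀ s t, dist (σ s) (σ t) < δ}

theorem inSet_mono [TopologicalSpace X] {U V : Set X} (h : U ⊆ V) (k : ℕ) :
    inSet U k ⊆ inSet V k :=
  fun _ hσ t => h (hσ t)

theorem lipIn_mono [MetricSpace X] {U V : Set X} (h : U ⊆ V) (k : ℕ) : lipIn U k ⊆ lipIn V k :=
  Set.inter_subset_inter_left _ (inSet_mono h k)

theorem lip_comp_affC [MetricSpace X] {n j : ℕ} {σ : C(Simplex n, X)} (hσ : σ ∈ lip X n)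
    (w : Fin (j + 1) → Simplex n) : σ.comp (affC w) ∈ lip X j := by
  obtain ⟨K, hK⟩ := hσ
  exact ⟨_, hK.comp (lipschitzWith_aff w)⟩

theorem lip_face [MetricSpace X] {k : ℕ} {σ : C(Simplex (k + 1), X)} (hσ : σ ∈ lip X (k + 1))
    (i : Fin (k + 2)) : σ.comp (faceMap i) ∈ lip X k := by
  rw [faceMap_eq_affC]
  exact lip_comp_affC hσ _

theorem lip_zero [MetricSpace X] (σ : C(Simplex 0, X)) : σ ∈ lip X 0 :=
  ⟨0, fun s t => by
    have : s = t := Subsingleton.elim (α := stdSimplex ℝ (Fin 1)) s t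
    simp [this]⟩

theorem inSet_face [TopologicalSpace X] {U : Set X} {k : ℕ} {σ : C(Simplex (k + 1), X)}
    (hσ : σ ∈ inSet U (k + 1)) (i : Fin (k + 2)) : σ.comp (faceMap i) ∈ inSet U k :=
  fun t => hσ (faceMap i t)

theorem small_face [MetricSpace X] {K : Set X} {δ : ℝ} {k : ℕ} {σ : C(Simplex (k + 1), X)}
    (hσ : σ ∈ small K δ (k + 1)) (i : Fin (k + 2)) : σ.comp (faceMap i) ∈ small K δ k :=
  ⟨inSet_face hσ.1 i, fun s t => hσ.2 (faceMap i s) (faceMap i t)⟩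

theorem small_mono [MetricSpace X] {K K' : Set X} {δ δ' : ℝ} (hK : K ⊆ K') (hδ : δ ≤ δ') (k : ℕ) :
    small K δ k ⊆ small K' δ' k :=
  fun _ hσ => ⟨inSet_mono hK k hσ.1, fun s t => (hσ.2 s t).trans_le hδ⟩

end Sets

namespace SChain

section Lip

variable {X : Type*} [MetricSpace X]

theorem d_gen_mem {k : ℕ} {N : Submodule ℤ (SChain X k)} {σ : C(Simplex (k + 1), X)}
    (h : ∀ i, gen (σ.comp (faceMap i)) ∈ N) : d X k (gen σ) ∈ N := by
  rw [d_gen]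
  exact sum_mem fun i _ => Submodule.smul_mem _ _ (h i)

theorem push_mem_lip {n : ℕ} {σ : C(Simplex n, X)} (hσ : σ ∈ lip X n) (j : ℕ)
    (c : OChain (Simplex n) j) : push σ j c ∈ chainsOn (lip X j) := by
  refine map_mem_of_chainsOn (fun w _ => ?_) (mem_chainsOn_univ c)
  rw [push_gen]
  exact gen_mem_chainsOn (lip_comp_affC hσ w)

theorem subdiv_mem_lip (N : ℕ) {k : ℕ} {c : SChain X k} (hc : c ∈ chainsOn (lip X k)) :
    subdiv X N k c ∈ chainsOn (lip X k) :=
  map_mem_of_chainsOn (fun _ hσ => by rw [subdiv_gen]; exact push_mem_lip hσ _ _) hc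

theorem subdivHomotopy_mem_lip (N : ℕ) {k : ℕ} {c : SChain X k} (hc : c ∈ chainsOn (lip X k)) :
    subdivHomotopy X N k c ∈ chainsOn (lip X (k + 1)) :=
  map_mem_of_chainsOn (fun σ hσ => by
    rw [← push_vertices σ, subdivHomotopy_push]; exact push_mem_lip hσ _ _) hc

/-- Iterated subdivision makes the simplices of a chain arbitrarily small, inside a fixed compact
set. -/
theorem exists_subdiv_mem_small {k : ℕ} (c : SChain X k) :
    ∃ K : Set X, IsCompact K ∧ ∀ δ > 0, ∃ N, ∀ M ≥ N, subdiv X M k c ∈ chainsOn (small K δ k) := by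
  induction c using Finsupp.induction_linear with
  | zero => exact ⟨∅, isCompact_empty, fun _ _ => ⟨0, fun M _ => by simp⟩⟩
  | add f g hf hg =>
    obtain ⟨K, hK, h⟩ := hf
    obtain ⟨K', hK', h'⟩ := hg
    refine ⟨K ∪ K', hK.union hK', fun δ hδ => ?_⟩
    obtain ⟨N, hN⟩ := h δ hδ
    obtain ⟨N', hN'⟩ := h' δ hδ
    refine ⟨max N N', fun M hM => ?_⟩
    rw [map_add]
    exact add_mem
      (chainsOn_mono (small_mono Set.subset_union_left le_rfl k) (hN M (le_of_max_le_left hM)))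
      (chainsOn_mono (small_mono Set.subset_union_right le_rfl k) (hN' M (le_of_max_le_right hM)))
  | single σ z =>
    refine ⟨Set.range σ, isCompact_range σ.continuous, fun δ hδ => ?_⟩
    -- `σ` is uniformly continuous, and the subdivision of `Δᵏ` has mesh at most `(k / (k + 1)) ^ M`.
    obtain ⟨η, hη, h⟩ := Metric.uniformContinuous_iff.1
      (CompactSpace.uniformContinuous_of_continuous σ.continuous) δ hδ
    have hq : (k / (k + 1) : ℝ) < 1 := by
      rw [div_lt_one (by positivity)]
      linarith
    obtain ⟨N, hN⟩ := exists_pow_lt_of_lt_one hη hq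
    refine ⟨N, fun M hM => ?_⟩
    have hM' : (k / (k + 1) : ℝ) ^ M < η :=
      (pow_le_pow_of_le_one (by positivity) hq.le hM).trans_lt hN
    have hz : Finsupp.single σ z = z • gen σ := by simp [gen]
    rw [hz, map_smul, subdiv_gen]
    refine Submodule.smul_mem _ _ (map_mem_of_chainsOn (fun w hw => ?_)
      (sdIter_gen_mem_chainsOn M k (vertices k)))
    rw [push_gen]
    exact gen_mem_chainsOn ⟨fun t => ⟨_, rfl⟩, fun s t =>
      h ((dist_aff_aff_le hw s t).trans_lt hM')⟩

/-- The cycles of a degree; in degree `0` every chain is a cycle. -/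
def IsCycle : ∀ n, SChain X n → Prop
  | 0, _ => True
  | n + 1, c => d X n c = 0

/-- The cycles of the augmented chain complex. -/
def IsReducedCycle : ∀ n, SChain X n → Prop
  | 0, c => aug X c = 0
  | n + 1, c => d X n c = 0

theorem isReducedCycle_d (n : ℕ) (c : SChain X (n + 1)) : IsReducedCycle n (d X n c) := by
  cases n with
  | zero => exact aug_d c
  | succ n => exact d_d n c

theorem isCycle_d (n : ℕ) (c : SChain X (n + 1)) : IsCycle n (d X n c) := by
  cases n with
  | zero => trivial
  | succ n => exact d_d n c

end Lip

end SChain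

/-! ### Local triviality in terms of chains -/

section Local

variable (X : Type*) [MetricSpace X]

open SChain

/-- Every neighbourhood `V` of a point contains a neighbourhood `U` with `R U V`. -/
def Locally (R : Set X → Set X → Prop) : Prop :=
  ∀ (x : X) (V : Set X), IsOpen V → x ∈ V → ∃ U ⊆ V, IsOpen U ∧ x ∈ U ∧ R U V

/-- Singular `n`-cycles in `U` bound in `V`. -/
def SingBounds (n : ℕ) (U V : Set X) : Prop :=
  ∀ z ∈ chainsOn (inSet U n), IsCycle n z → ∃ b ∈ chainsOn (inSet V (n + 1)), d X n b = z

/-- Reduced Lipschitz `n`-cycles in `U` bound Lipschitz chains in `V`. -/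
def LipBounds (n : ℕ) (U V : Set X) : Prop :=
  ∀ z ∈ chainsOn (lipIn U n), IsReducedCycle n z → ∃ b ∈ chainsOn (lipIn V (n + 1)), d X n b = z

/-- Cycles of `S(U) / S^L(U)` of degree `n + 1` bound in `S(V) / S^L(V)`. -/
def QuotBounds (n : ℕ) (U V : Set X) : Prop :=
  ∀ a ∈ chainsOn (inSet U (n + 1)), d X n a ∈ chainsOn (lipIn U n) →
    ∃ b ∈ chainsOn (inSet V (n + 2)), a - d X (n + 1) b ∈ chainsOn (lipIn V (n + 1))

variable {X}

/-- Over a compact set, local triviality holds for balls of uniform radius. -/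
theorem Locally.exists_ball {R : Set X → Set X → Prop} (h : Locally X R)
    (hR : ∀ ⦃U U' V V'⦄, U' ⊆ U → V ⊆ V' → R U V → R U' V') {K : Set X} (hK : IsCompact K)
    {ε : ℝ} (hε : 0 < ε) : ∃ δ > 0, ∀ x ∈ K, R (ball x δ) (ball x ε) := by
  refine hK.induction_on (p := fun S => ∃ δ > 0, ∀ x ∈ S, R (ball x δ) (ball x ε))
    ⟨1, one_pos, by simp⟩ (fun s t hst ⟨δ, hδ, h⟩ => ⟨δ, hδ, fun x hx => h x (hst hx)⟩) ?_ ?_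
  · rintro s t ⟨δ, hδ, h⟩ ⟨δ', hδ', h'⟩
    refine ⟨min δ δ', lt_min hδ hδ', fun x hx => ?_⟩
    rcases hx with hx | hx
    · exact hR (ball_subset_ball (min_le_left _ _)) subset_rfl (h x hx)
    · exact hR (ball_subset_ball (min_le_right _ _)) subset_rfl (h' x hx)
  · intro x _
    obtain ⟨U, -, hU, hxU, hUV⟩ := h x (ball x (ε / 2)) isOpen_ball (mem_ball_self (by linarith))
    obtain ⟨r, hr, hrU⟩ := Metric.isOpen_iff.1 hU x hxU
    refine ⟨ball x (min (r / 2) (ε / 2)), mem_nhdsWithin_of_mem_nhds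
      (ball_mem_nhds x (by positivity)), r / 2, by positivity, fun y hy => hR ?_ ?_ hUV⟩
    · have : dist y x < r / 2 := (mem_ball.1 hy).trans_le (min_le_left _ _)
      exact (ball_subset_ball' (by linarith)).trans hrU
    · have : dist y x < ε / 2 := (mem_ball.1 hy).trans_le (min_le_right _ _)
      refine ball_subset_ball' ?_
      rw [dist_comm]
      linarith

theorem LipBounds.mono {n : ℕ} ⦃U U' V V' : Set X⦄ (hU : U' ⊆ U) (hV : V ⊆ V')
    (h : LipBounds X n U V) : LipBounds X n U' V' := fun z hz hz' => by
  obtain ⟨b, hb, rfl⟩ := h z (chainsOn_mono (lipIn_mono hU n) hz) hz'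
  exact ⟨b, chainsOn_mono (lipIn_mono hV _) hb, rfl⟩

theorem QuotBounds.mono {n : ℕ} ⦃U U' V V' : Set X⦄ (hU : U' ⊆ U) (hV : V ⊆ V')
    (h : QuotBounds X n U V) : QuotBounds X n U' V' := fun a ha ha' => by
  obtain ⟨b, hb, hab⟩ := h a (chainsOn_mono (inSet_mono hU _) ha) (chainsOn_mono (lipIn_mono hU n) ha')
  exact ⟨b, chainsOn_mono (inSet_mono hV _) hb, chainsOn_mono (lipIn_mono hV _) hab⟩

/-- The quotient of singular by Lipschitz chains is locally trivial in degree `n + 1`, by the two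
adjacent terms of its long exact sequence. -/
theorem locally_quotBounds {n : ℕ} (hL : Locally X (LipBounds X n))
    (hS : Locally X (SingBounds X (n + 1))) : Locally X (QuotBounds X n) := by
  intro x V hV hx
  obtain ⟨W, hWV, hW, hxW, hS⟩ := hS x V hV hx
  obtain ⟨U, hUW, hU, hxU, hL⟩ := hL x W hW hxW
  refine ⟨U, hUW.trans hWV, hU, hxU, fun a ha hda => ?_⟩
  obtain ⟨l, hl, hdl⟩ := hL _ hda (isReducedCycle_d n a)
  have hl' : l ∈ chainsOn (inSet W (n + 1)) := chainsOn_mono Set.inter_subset_left hl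
  obtain ⟨b, hb, hdb⟩ := hS (a - l) (sub_mem (chainsOn_mono (inSet_mono hUW _) ha) hl')
    (by simp [IsCycle, hdl])
  refine ⟨b, hb, ?_⟩
  rw [hdb, sub_sub_cancel]
  exact chainsOn_mono (lipIn_mono hWV _) hl

/-! ### The deformation of small simplices to Lipschitz chains -/

/-- The first vertex of a singular simplex. -/
def vert {n : ℕ} (σ : C(Simplex n, X)) : X := σ (vertices n 0)

theorem ball_vert_subset {K : Set X} {ε ε' δ : ℝ} {n : ℕ} {σ : C(Simplex (n + 1), X)}
    (hσ : σ ∈ small K δ (n + 1)) (h : ε + δ ≤ ε') (i : Fin (n + 2)) :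
    ball (vert (σ.comp (faceMap i))) ε ⊆ ball (vert σ) ε' := by
  refine ball_subset_ball' ?_
  have : dist (vert (σ.comp (faceMap i))) (vert σ) < δ := hσ.2 _ _
  linarith

theorem small_subset_ball {K : Set X} {ε δ : ℝ} {n : ℕ} {σ : C(Simplex n, X)}
    (hσ : σ ∈ small K δ n) (h : δ ≤ ε) : σ ∈ inSet (ball (vert σ) ε) n :=
  fun _ => mem_ball.2 ((hσ.2 _ _).trans_le h)

/-- If the quotient of singular by Lipschitz chains is locally trivial in degrees `1, …, n`, then
small singular `n`-chains are deformed to Lipschitz chains by a homotopy that does not move chains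
far and vanishes on Lipschitz chains. The last clause, for cycles of any support `W`, serves both
for the boundary of a single simplex and for a global cycle. -/
theorem exists_deformation (n : ℕ) (hQ : ∀ k < n, Locally X (QuotBounds X k)) {K : Set X}
    (hK : IsCompact K) {ε : ℝ} (hε : 0 < ε) :
    ∃ δ > 0, δ ≤ ε ∧ ∃ h : SChain X n →ₗ[ℤ] SChain X (n + 1),
      (∀ σ ∈ small K δ n, h (gen σ) ∈ chainsOn (inSet (ball (vert σ) ε) (n + 1))) ∧
      (∀ σ ∈ lip X n, h (gen σ) = 0) ∧
      ∀ (W : Set X), ∀ c ∈ chainsOn {σ | σ ∈ small K δ n ∧ ball (vert σ) ε ⊆ W}, IsCycle n c →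
        c - d X n (h c) ∈ chainsOn (lipIn W n) := by
  classical
  induction n generalizing ε with
  | zero =>
    refine ⟨ε, hε, le_rfl, 0, fun σ _ => by simp, fun σ _ => by simp, fun W c hc _ => ?_⟩
    simp only [LinearMap.zero_apply, map_zero, sub_zero]
    refine chainsOn_mono (fun σ hσ => ?_) hc
    exact ⟨inSet_mono hσ.2 0 (small_subset_ball hσ.1 le_rfl), lip_zero σ⟩
  | succ n ih =>
    -- The chain `σ - h ∂σ` has to lie in the ball of radius `ε'` where cycles of the quotient bound;
    -- half of that radius is spent on `h`, the other half on the diameter of `σ`.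
    obtain ⟨ε', hε', hfill⟩ := (hQ n n.lt_succ_self).exists_ball QuotBounds.mono hK hε
    have hεε : 0 < min ε' ε := lt_min hε' hε
    obtain ⟨δ, hδ, hδε, h, h_ball, h_lip, h_def⟩ :=
      ih (fun k hk => hQ k (hk.trans n.lt_succ_self)) (half_pos hεε)
    have hδ₁ : min ε' ε / 2 + δ ≤ ε' := by linarith [min_le_left ε' ε]
    have hδ₂ : δ ≤ ε' := by linarith [min_le_left ε' ε]
    have hδ₃ : δ ≤ ε := by linarith [min_le_right ε' ε]
    have h_lip_d : ∀ σ ∈ lip X (n + 1), h (d X n (gen σ)) = 0 := fun σ hσ => by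
      simp [d_gen, h_lip _ (lip_face hσ _)]
    have key : ∀ σ : C(Simplex (n + 1), X), ∃ b : SChain X (n + 2), (σ ∈ lip X (n + 1) → b = 0) ∧
        (σ ∈ small K δ (n + 1) → b ∈ chainsOn (inSet (ball (vert σ) ε) (n + 2)) ∧
          gen σ - h (d X n (gen σ)) - d X (n + 1) b ∈ chainsOn (lipIn (ball (vert σ) ε) (n + 1))) := by
      intro σ
      by_cases hl : σ ∈ lip X (n + 1)
      · refine ⟨0, fun _ => rfl, fun hs => ⟨zero_mem _, ?_⟩⟩
        rw [h_lip_d σ hl, map_zero, sub_zero, sub_zero]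
        exact gen_mem_chainsOn ⟨small_subset_ball hs hδ₃, hl⟩
      by_cases hs : σ ∈ small K δ (n + 1)
      -- `σ - h ∂σ` is a cycle of the quotient, as its boundary `∂σ - ∂h ∂σ` is Lipschitz.
      · have hd : d X n (gen σ) ∈
            chainsOn {τ | τ ∈ small K δ n ∧ ball (vert τ) (min ε' ε / 2) ⊆ ball (vert σ) ε'} :=
          d_gen_mem fun i => gen_mem_chainsOn ⟨small_face hs i, ball_vert_subset hs hδ₁ i⟩
        obtain ⟨b, hb, hb'⟩ := hfill (vert σ) (hs.1 _) (gen σ - h (d X n (gen σ)))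
          (sub_mem (gen_mem_chainsOn (small_subset_ball hs hδ₂))
            (map_mem_of_chainsOn (fun τ hτ => chainsOn_mono (inSet_mono hτ.2 _) (h_ball τ hτ.1)) hd))
          (by rw [map_sub]; exact h_def _ _ hd (isCycle_d n _))
        exact ⟨b, fun h => absurd h hl, fun _ => ⟨hb, hb'⟩⟩
      · exact ⟨0, fun _ => rfl, fun h => absurd h hs⟩
    choose b hb_lip hb using key
    refine ⟨δ, hδ, hδ₃, lift b, fun σ hσ => ?_, fun σ hσ => ?_, fun W c hc hcyc => ?_⟩
    · rw [lift_gen]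
      exact (hb σ hσ).1
    · rw [lift_gen]
      exact hb_lip σ hσ
    -- For a cycle `c`, the term `h ∂c` of `c - h ∂c - ∂b c` vanishes.
    · have hmem := map_mem_of_chainsOn (N := chainsOn (lipIn W (n + 1)))
        (f := LinearMap.id - h ∘ₗ d X n - d X (n + 1) ∘ₗ lift b)
        (fun σ hσ => by simpa using chainsOn_mono (lipIn_mono hσ.2 _) (hb σ hσ.1).2) hc
      have hcyc' : d X n c = 0 := hcyc
      simpa [hcyc'] using hmem

/-- Every singular cycle is homologous to a Lipschitz cycle. -/
theorem exists_sub_d_mem_lip (n : ℕ) (hQ : ∀ k < n, Locally X (QuotBounds X k)) (c : SChain X n)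
    (hc : IsCycle n c) : ∃ b, c - d X n b ∈ chainsOn (lip X n) := by
  cases n with
  | zero => exact ⟨0, by simpa using chainsOn_mono (fun σ _ => lip_zero σ) (mem_chainsOn_univ c)⟩
  | succ n =>
    obtain ⟨K, hK, hsmall⟩ := exists_subdiv_mem_small c
    obtain ⟨δ, hδ, -, h, -, -, h_def⟩ := exists_deformation (n + 1) hQ hK one_pos
    obtain ⟨N, hN⟩ := hsmall δ hδ
    have hc' : d X n c = 0 := hc
    have hd : d X n (subdiv X N (n + 1) c) = 0 := by rw [d_subdiv, hc', map_zero]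
    have hsub : small K δ (n + 1) ⊆
        {σ | σ ∈ small K δ (n + 1) ∧ ball (vert σ) 1 ⊆ Set.univ} :=
      fun σ hσ => ⟨hσ, Set.subset_univ _⟩
    have := h_def Set.univ _ (chainsOn_mono hsub (hN N le_rfl)) hd
    refine ⟨subdivHomotopy X N (n + 1) c + h (subdiv X N (n + 1) c), ?_⟩
    rw [map_add, d_subdivHomotopy, hc', map_zero]
    have h2 := chainsOn_mono (s := lipIn Set.univ (n + 1)) Set.inter_subset_right this
    convert h2 using 1
    abel

/-- A Lipschitz cycle that bounds a singular chain bounds a Lipschitz chain. -/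
theorem exists_lip_d_eq (n : ℕ) (hQ : ∀ k < n, Locally X (QuotBounds X k))
    (hL : Locally X (LipBounds X n)) (c : SChain X (n + 1)) (hc : d X n c ∈ chainsOn (lip X n)) :
    ∃ b ∈ chainsOn (lip X (n + 1)), d X n b = d X n c := by
  classical
  obtain ⟨K, hK, hsmall⟩ := exists_subdiv_mem_small c
  obtain ⟨ε, hε, hfill⟩ := hL.exists_ball LipBounds.mono hK one_pos
  obtain ⟨δ, hδ, hδε, h, -, h_lip, h_def⟩ := exists_deformation n hQ hK (half_pos hε)
  obtain ⟨N, hN⟩ := hsmall δ hδ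
  have key : ∀ σ : C(Simplex (n + 1), X), ∃ b, σ ∈ small K δ (n + 1) →
      b ∈ chainsOn (lip X (n + 1)) ∧ d X n b = d X n (gen σ) - d X n (h (d X n (gen σ))) := by
    intro σ
    by_cases hs : σ ∈ small K δ (n + 1)
    · have hd : d X n (gen σ) ∈
          chainsOn {τ | τ ∈ small K δ n ∧ ball (vert τ) (ε / 2) ⊆ ball (vert σ) ε} :=
        d_gen_mem fun i => gen_mem_chainsOn ⟨small_face hs i, ball_vert_subset hs (by linarith) i⟩
      obtain ⟨b, hb, hdb⟩ := hfill (vert σ) (hs.1 _) _ (h_def _ _ hd (isCycle_d n _))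
        (by rw [← map_sub]; exact isReducedCycle_d n _)
      exact ⟨b, fun _ => ⟨chainsOn_mono Set.inter_subset_right hb, hdb⟩⟩
    · exact ⟨0, fun h => absurd h hs⟩
  choose l hl using key
  have hlip : lift l (subdiv X N (n + 1) c) ∈ chainsOn (lip X (n + 1)) :=
    map_mem_of_chainsOn (fun σ hσ => by rw [lift_gen]; exact (hl σ hσ).1) (hN N le_rfl)
  have heq := map_eq_of_chainsOn (f := d X n ∘ₗ lift l)
    (g := d X n - d X n ∘ₗ h ∘ₗ d X n) (fun σ hσ => by simpa using (hl σ hσ).2) (hN N le_rfl)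
  -- `h ∂c` vanishes for the subdivided chain, whose boundary is Lipschitz.
  have hzero : h (d X n (subdiv X N (n + 1) c)) = 0 := by
    rw [d_subdiv]
    exact map_eq_of_chainsOn (g := 0) h_lip (subdiv_mem_lip N hc)
  simp only [LinearMap.comp_apply, LinearMap.sub_apply] at heq
  rw [hzero, map_zero, sub_zero, d_subdiv] at heq
  -- The boundary `∂c` differs from its subdivision by the boundary of a Lipschitz chain.
  cases n with
  | zero => exact ⟨_, hlip, by rw [heq, subdiv_zero_right]⟩
  | succ n =>
    refine ⟨_, add_mem hlip (subdivHomotopy_mem_lip N hc), ?_⟩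
    rw [map_add, heq, d_subdivHomotopy, d_d, map_zero]
    abel

end Local

/-! ### Lipschitz contractions -/

namespace SChain

section Prism

variable {V U : Type*} [MetricSpace V] [MetricSpace U]

/-- The coordinate of `Δ¹` with value `0` at the vertex `0` and `1` at the vertex `1`. -/
def coord (t : Simplex 1) : unitInterval := ⟨t.1 1, t.2.1 1, stdSimplex.le_one t 1⟩

theorem lipschitzWith_coord : LipschitzWith 1 coord :=
  LipschitzWith.of_dist_le_mul fun s t => by
    simpa using! dist_le_pi_dist s.1 t.1 1

/-- The singular simplex of `U` obtained from `h : V × [0, 1] → U`, a singular simplex `σ` of `V`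
and a tuple of points in the prism `Δⁿ × Δ¹`. -/
def prismSimplex (h : C(V × unitInterval, U)) {n : ℕ} (σ : C(Simplex n, V)) (j : ℕ)
    (w : Fin (j + 1) → Simplex n × Simplex 1) : C(Simplex j, U) :=
  h.comp ((σ.comp (affC (Prod.fst ∘ w))).prodMk
    ((ContinuousMap.mk coord lipschitzWith_coord.continuous).comp (affC (Prod.snd ∘ w))))

/-- The prism homotopy between the two ends of `Δⁿ × Δ¹`, on ordered chains. -/
def prism (n j : ℕ) : OChain (Simplex n) j →ₗ[ℤ] OChain (Simplex n × Simplex 1) (j + 1) :=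
  OChain.homotopy (OChain.map fun x => (x, vertices 1 0)) (OChain.map fun x => (x, vertices 1 1))
    (fun _ v => (v 0, vertices 1 0)) j

/-- The singular chains of `U` obtained from `h : V × [0, 1] → U`, a singular simplex of `V` and
ordered chains of the prism. -/
def pushPrism (h : C(V × unitInterval, U)) {n : ℕ} (σ : C(Simplex n, V)) (j : ℕ) :
    OChain (Simplex n × Simplex 1) j →ₗ[ℤ] SChain U j :=
  realize (prismSimplex h σ) j

/-- The prism operator of a homotopy. -/
def prismOp (h : C(V × unitInterval, U)) (k : ℕ) : SChain V k →ₗ[ℤ] SChain U (k + 1) :=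
  natural (s := 1) (E := fun n => Simplex n × Simplex 1) prism (pushPrism h) k

theorem d_pushPrism (h : C(V × unitInterval, U)) {n : ℕ} (σ : C(Simplex n, V)) (j : ℕ)
    (c : OChain (Simplex n × Simplex 1) (j + 1)) :
    d U j (pushPrism h σ (j + 1) c) = pushPrism h σ j (OChain.d _ j c) := by
  refine d_realize (fun j w i => ?_) j c
  simp only [prismSimplex, ← Function.comp_assoc, ← affC_comp_faceMap]
  rfl

theorem pushPrism_map (h : C(V × unitInterval, U)) {n : ℕ} (σ : C(Simplex n, V)) (a : Fin 2)
    {f : C(V, U)} (hf : ∀ v, h (v, coord (vertices 1 a)) = f v) (j : ℕ)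
    (c : OChain (Simplex n) j) :
    pushPrism h σ j (OChain.map (fun x => (x, vertices 1 a)) j c) = map f j (push σ j c) := by
  refine hom_congr (f := pushPrism h σ j ∘ₗ OChain.map (fun x => (x, vertices 1 a)) j)
    (g := map f j ∘ₗ push σ j) (fun w => ?_) c
  simp only [LinearMap.comp_apply, OChain.map_gen, pushPrism, realize_gen, push_gen, map_gen]
  congr 1
  ext t
  have ht : aff (fun _ : Fin (j + 1) => vertices 1 a) t = vertices 1 a :=
    dist_le_zero.1 (dist_aff_le (fun _ => (dist_self _).le) t)
  change h (σ (aff w t), coord (aff (fun _ => vertices 1 a) t)) = f (σ (aff w t))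
  rw [ht, hf]

theorem prismOp_push (h : C(V × unitInterval, U)) {n : ℕ} (σ : C(Simplex n, V)) (k : ℕ)
    (c : OChain (Simplex n) k) :
    prismOp h k (push σ k c) = pushPrism h σ (k + 1) (prism n k c) := by
  refine natural_push (s := 1) (E := fun n => Simplex n × Simplex 1)
    (fun w => Prod.map (aff w) id) (fun w j c => ?_) (fun σ w j c => ?_) σ k c
  · refine OChain.map_homotopy (fun _ _ => rfl) (fun k c => ?_) (fun k c => ?_) j c
    all_goals
      refine hom_congr (f := OChain.map _ k ∘ₗ OChain.map _ k)
        (g := OChain.map _ k ∘ₗ OChain.map _ k) (fun v => ?_) c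
      simp only [LinearMap.comp_apply, OChain.map_gen]
      rfl
  · refine hom_congr (f := pushPrism h (σ.comp (affC w)) j)
      (g := pushPrism h σ j ∘ₗ OChain.map (Prod.map (aff w) id) j) (fun v => ?_) c
    simp only [LinearMap.comp_apply, OChain.map_gen, pushPrism, realize_gen]
    congr 1
    ext t
    change h (σ (aff w (aff (Prod.fst ∘ v) t)), coord (aff (Prod.snd ∘ v) t)) =
      h (σ (aff (aff w ∘ Prod.fst ∘ v) t), coord (aff (Prod.snd ∘ v) t))
    rw [aff_aff]

variable {h : C(V × unitInterval, U)} {f g : C(V, U)}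

theorem d_prismOp_zero (hf : ∀ v, h (v, 0) = f v) (hg : ∀ v, h (v, 1) = g v) (c : SChain V 0) :
    d U 0 (prismOp h 0 c) = map g 0 c - map f 0 c := by
  have h0 : coord (vertices 1 0) = 0 := Subtype.ext (by simp [coord, vertices])
  have h1 : coord (vertices 1 1) = 1 := Subtype.ext (by simp [coord, vertices])
  refine hom_congr (f := d U 0 ∘ₗ prismOp h 0) (g := map g 0 - map f 0) (fun σ => ?_) c
  simp only [LinearMap.comp_apply, LinearMap.sub_apply]
  rw [← push_vertices, prismOp_push, d_pushPrism, prism,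
    OChain.d_homotopy_zero (fun c => by simp [OChain.aug_map]), map_sub,
    pushPrism_map h σ 0 (by rwa [h0]), pushPrism_map h σ 1 (by rwa [h1])]

theorem d_prismOp_succ (hf : ∀ v, h (v, 0) = f v) (hg : ∀ v, h (v, 1) = g v) (k : ℕ)
    (c : SChain V (k + 1)) : d U (k + 1) (prismOp h (k + 1) c) =
      map g (k + 1) c - map f (k + 1) c - prismOp h k (d V k c) := by
  have h0 : coord (vertices 1 0) = 0 := Subtype.ext (by simp [coord, vertices])
  have h1 : coord (vertices 1 1) = 1 := Subtype.ext (by simp [coord, vertices])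
  refine hom_congr (f := d U (k + 1) ∘ₗ prismOp h (k + 1))
    (g := map g (k + 1) - map f (k + 1) - prismOp h k ∘ₗ d V k) (fun σ => ?_) c
  simp only [LinearMap.comp_apply, LinearMap.sub_apply]
  rw [← push_vertices, prismOp_push, d_pushPrism, prism,
    OChain.d_homotopy_succ (fun c => by simp [OChain.aug_map])
      (fun k c => (OChain.map_d _ k c).symm) (fun k c => (OChain.map_d _ k c).symm),
    map_sub, map_sub, pushPrism_map h σ 0 (by rwa [h0]), pushPrism_map h σ 1 (by rwa [h1]),
    d_push, prismOp_push, prism]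

theorem prismOp_mem_lip (hh : ∃ K, LipschitzWith K h) {k : ℕ} {c : SChain V k}
    (hc : c ∈ chainsOn (lip V k)) : prismOp h k c ∈ chainsOn (lip U (k + 1)) := by
  obtain ⟨K, hK⟩ := hh
  refine map_mem_of_chainsOn (fun σ hσ => ?_) hc
  obtain ⟨L, hL⟩ := hσ
  rw [← push_vertices σ, prismOp_push]
  refine map_mem_of_chainsOn (fun w _ => ?_) (mem_chainsOn_univ _)
  rw [pushPrism, realize_gen]
  exact gen_mem_chainsOn ⟨_, hK.comp ((hL.comp (lipschitzWith_aff (Prod.fst ∘ w))).prodMk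
    (lipschitzWith_coord.comp (lipschitzWith_aff (Prod.snd ∘ w))))⟩

/-- The reduced homology of a point vanishes. -/
theorem exists_d_eq_map_const (x₀ : U) (k : ℕ) (c : SChain V k) (hc : IsReducedCycle k c) :
    ∃ b ∈ chainsOn (lip U (k + 1)), d U k b = map (ContinuousMap.const V x₀) k c := by
  let κ : ∀ k, C(Simplex k, U) := fun k => ContinuousMap.const _ x₀
  let total : ∀ k, SChain V k →ₗ[ℤ] ℤ := fun k => lift fun _ => 1
  have hmap : map (ContinuousMap.const V x₀) k c = total k c • gen (κ k) := by
    refine hom_congr (f := map (ContinuousMap.const V x₀) k)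
      (g := (total k).smulRight (gen (κ k))) (fun σ => ?_) c
    simp [total, κ, ContinuousMap.const_comp]
  have hd : ∀ k, d U k (gen (κ (k + 1))) = (if Even (k + 2) then 0 else 1 : ℤ) • gen (κ k) := by
    intro k
    rw [d_gen, ← Fin.sum_neg_one_pow, Finset.sum_smul]
    rfl
  have htotal : ∀ k (c : SChain V (k + 1)),
      total k (d V k c) = (if Even (k + 2) then 0 else 1 : ℤ) * total (k + 1) c := by
    intro k c
    refine hom_congr (f := total k ∘ₗ d V k)
      (g := (if Even (k + 2) then 0 else 1 : ℤ) • total (k + 1)) (fun σ => ?_) c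
    simp [total, d_gen, ← Fin.sum_neg_one_pow]
  rw [hmap]
  -- For odd `k` the constant `k`-simplex is the boundary of the constant `(k + 1)`-simplex; for even
  -- `k` the sum of the coefficients of a reduced cycle vanishes.
  by_cases hk : Even (k + 2)
  · refine ⟨0, zero_mem _, ?_⟩
    have : total k c = 0 := by
      cases k with
      | zero => exact hc
      | succ k =>
        have h := htotal k c
        rw [show d V k c = 0 from hc, map_zero, if_neg (by grind)] at h
        simpa using h.symm
    simp [this]
  · refine ⟨total k c • gen (κ (k + 1)), Submodule.smul_mem _ _
      (gen_mem_chainsOn ⟨0, LipschitzWith.const x₀⟩), ?_⟩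
    rw [map_smul, hd, if_neg hk, one_smul]

/-- A map that is Lipschitz homotopic to a constant map is trivial on reduced homology, both
singular and Lipschitz. -/
theorem exists_d_eq_map_of_contraction (hh : ∃ K, LipschitzWith K h) (hf : ∀ v, h (v, 0) = f v)
    {x₀ : U} (hx₀ : ∀ v, h (v, 1) = x₀) (k : ℕ) (c : SChain V k) (hc : IsReducedCycle k c) :
    ∃ b, (c ∈ chainsOn (lip V k) → b ∈ chainsOn (lip U (k + 1))) ∧ d U k b = map f k c := by
  obtain ⟨b, hb, hdb⟩ := exists_d_eq_map_const x₀ k c hc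
  refine ⟨b - prismOp h k c, fun hc => sub_mem hb (prismOp_mem_lip hh hc), ?_⟩
  cases k with
  | zero =>
    rw [map_sub, hdb, d_prismOp_zero (g := ContinuousMap.const V x₀) hf hx₀, sub_sub_cancel]
  | succ k =>
    rw [map_sub, hdb, d_prismOp_succ (g := ContinuousMap.const V x₀) hf hx₀,
      show d V k c = 0 from hc, map_zero, sub_zero, sub_sub_cancel]

end Prism

end SChain

/-! ### Chains of simplicial sets as free abelian groups -/

section Chains

variable (K : SSet.{u}) {n : ℕ} {α β : Type u}

/-- The homomorphism from the `n`-chains of a simplicial set to the free abelian group on `α` given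
by a map from the `n`-simplices to `α`. -/
def chainHom (q : K.obj (Opposite.op (SimplexCategory.mk n)) → α) :
    (chains.obj K).X n ⟶ AddCommGrpCat.of (α →₀ ℤ) :=
  Sigma.desc fun x => AddCommGrpCat.ofHom
    ((Finsupp.singleAddHom (q x)).comp (AddEquiv.ulift : ULift.{u} ℤ ≃+ ℤ).toAddMonoidHom)

variable {K}

theorem chainHom_ι (q : K.obj (Opposite.op (SimplexCategory.mk n)) → α)
    (x : K.obj (Opposite.op (SimplexCategory.mk n))) :
    K.ιChainComplex (R := intCoeff) x ≫ chainHom K q = AddCommGrpCat.ofHom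
      ((Finsupp.singleAddHom (q x)).comp (AddEquiv.ulift : ULift.{u} ℤ ≃+ ℤ).toAddMonoidHom) :=
  Sigma.ι_desc _ _

/-- The chain given by a simplex. -/
def chainGen (x : K.obj (Opposite.op (SimplexCategory.mk n))) : (chains.obj K).X n :=
  K.ιChainComplex (R := intCoeff) x ⟨1⟩

@[simp]
theorem chainHom_chainGen (q : K.obj (Opposite.op (SimplexCategory.mk n)) → α)
    (x : K.obj (Opposite.op (SimplexCategory.mk n))) :
    chainHom K q (chainGen x) = gen (q x) := by
  exact ConcreteCategory.congr_hom (chainHom_ι q x) ⟨1⟩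

theorem chains_hom_congr {M : Type u} [AddCommGroup M] {φ ψ : (chains.obj K).X n →+ M}
    (h : ∀ x, φ (chainGen x) = ψ (chainGen x)) (c : (chains.obj K).X n) : φ c = ψ c := by
  have : AddCommGrpCat.ofHom φ = AddCommGrpCat.ofHom ψ := by
    refine SSet.chainComplex_hom_ext fun x => ?_
    ext ⟨z⟩
    have hz : (⟨z⟩ : ULift.{u} ℤ) = z • ⟨1⟩ := by ext; simp
    have hx : φ (K.ιChainComplex (R := intCoeff) x ⟨1⟩) =
      ψ (K.ιChainComplex (R := intCoeff) x ⟨1⟩) := h x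
    change φ (K.ιChainComplex (R := intCoeff) x ⟨z⟩) = ψ (K.ιChainComplex (R := intCoeff) x ⟨z⟩)
    rw [hz, map_zsmul, map_zsmul, map_zsmul, hx]
  exact ConcreteCategory.congr_hom this c

theorem d_chainGen (x : K.obj (Opposite.op (SimplexCategory.mk (n + 1)))) :
    (chains.obj K).d (n + 1) n (chainGen x) =
      ∑ i : Fin (n + 2), (-1 : ℤ) ^ (i : ℕ) • chainGen (K.δ i x) := by
  have := ConcreteCategory.congr_hom (SSet.ιChainComplex_d (X := K) (R := intCoeff) x) ⟨1⟩
  let ev : ((intCoeff : AddCommGrpCat.{u}) ⟶ (chains.obj K).X n) →+ (chains.obj K).X n :=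
    { toFun := fun φ => φ ⟨1⟩, map_zero' := rfl, map_add' := fun _ _ => rfl }
  refine this.trans ((map_sum ev _ _).trans (Finset.sum_congr rfl fun i _ => ?_))
  exact map_zsmul ev _ _

theorem map_chainGen {K' : SSet.{u}} (f : K ⟶ K')
    (x : K.obj (Opposite.op (SimplexCategory.mk n))) :
    (chains.map f).f n (chainGen x) = chainGen (f.app _ x) :=
  ConcreteCategory.congr_hom (SSet.ι_chainComplexMap_f _ _ f (R := intCoeff) x) ⟨1⟩

theorem chainHom_d (q : K.obj (Opposite.op (SimplexCategory.mk (n + 1))) → α)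
    (q' : K.obj (Opposite.op (SimplexCategory.mk n)) → β) (D : (α →₀ ℤ) →ₗ[ℤ] (β →₀ ℤ))
    (h : ∀ x, D (gen (q x)) = ∑ i : Fin (n + 2), (-1 : ℤ) ^ (i : ℕ) • gen (q' (K.δ i x)))
    (c : (chains.obj K).X (n + 1)) :
    chainHom K q' ((chains.obj K).d (n + 1) n c) = D (chainHom K q c) := by
  refine chains_hom_congr (φ := ((chains.obj K).d (n + 1) n ≫ chainHom K q').hom)
    (ψ := D.toAddMonoidHom.comp (chainHom K q).hom) (fun x => ?_) c
  change chainHom K q' ((chains.obj K).d (n + 1) n (chainGen x)) = D (chainHom K q (chainGen x))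
  rw [chainHom_chainGen, h, d_chainGen, map_sum]
  exact Finset.sum_congr rfl fun i _ => by rw [map_zsmul, chainHom_chainGen]

theorem chainHom_map {K' : SSet.{u}} (f : K ⟶ K')
    (q : K.obj (Opposite.op (SimplexCategory.mk n)) → α)
    (q' : K'.obj (Opposite.op (SimplexCategory.mk n)) → β) (F : (α →₀ ℤ) →ₗ[ℤ] (β →₀ ℤ))
    (h : ∀ x, F (gen (q x)) = gen (q' (f.app _ x))) (c : (chains.obj K).X n) :
    chainHom K' q' ((chains.map f).f n c) = F (chainHom K q c) := by
  refine chains_hom_congr (φ := ((chains.map f).f n ≫ chainHom K' q').hom)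
    (ψ := F.toAddMonoidHom.comp (chainHom K q).hom) (fun x => ?_) c
  change chainHom K' q' ((chains.map f).f n (chainGen x)) = F (chainHom K q (chainGen x))
  rw [chainHom_chainGen, h, map_chainGen, chainHom_chainGen]

theorem chainHom_injective {q : K.obj (Opposite.op (SimplexCategory.mk n)) → α}
    (hq : Function.Injective q) : Function.Injective (chainHom K q) := by
  let r : (α →₀ ℤ) →+ (chains.obj K).X n := (Finsupp.liftAddHom fun a =>
    zmultiplesHom _ (open Classical in if h : ∃ x, q x = a then chainGen h.choose else 0))
  refine Function.LeftInverse.injective (g := r) fun c => ?_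
  refine chains_hom_congr (φ := r.comp (chainHom K q).hom) (ψ := AddMonoidHom.id _)
    (fun x => ?_) c
  change r (chainHom K q (chainGen x)) = chainGen x
  rw [chainHom_chainGen]
  have hx : ∃ y, q y = q x := ⟨x, rfl⟩
  have : hx.choose = x := hq hx.choose_spec
  simp only [r, gen, Finsupp.liftAddHom_apply_single, dif_pos hx, this, zmultiplesHom_apply,
    one_smul]

theorem exists_chainHom_eq (q : K.obj (Opposite.op (SimplexCategory.mk n)) → α) {c : α →₀ ℤ}
    (hc : c ∈ chainsOn (Set.range q)) : ∃ x, chainHom K q x = c := by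
  refine Submodule.span_le (p := AddSubgroup.toIntSubmodule (chainHom K q).hom.range) |>.2 ?_ hc
  rintro _ ⟨_, ⟨x, rfl⟩, rfl⟩
  exact ⟨chainGen x, chainHom_chainGen q x⟩

theorem chainHom_mem (q : K.obj (Opposite.op (SimplexCategory.mk n)) → α)
    (c : (chains.obj K).X n) : chainHom K q c ∈ chainsOn (Set.range q) := by
  have := chains_hom_congr
    (φ := ((Submodule.mkQ (chainsOn (Set.range q))).toAddMonoidHom.comp (chainHom K q).hom))
    (ψ := 0) (fun x => ?_) c
  · exact (Submodule.Quotient.mk_eq_zero _).1 this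
  · change (Submodule.mkQ _) (chainHom K q (chainGen x)) = 0
    rw [chainHom_chainGen]
    exact (Submodule.Quotient.mk_eq_zero _).2 (gen_mem_chainsOn ⟨x, rfl⟩)

end Chains

/-! ### Homology classes of complexes of abelian groups -/

section Homology

variable {C D : ChainComplex AddCommGrpCat.{u} ℕ} (f : C ⟶ D) (k : ℕ)

open HomologicalComplex

theorem exists_homologyπ_eq (x : C.homology k) : ∃ z, C.homologyπ k z = x :=
  (AddCommGrpCat.epi_iff_surjective _).1 inferInstance x

theorem iCycles_injective : Function.Injective (C.iCycles k) :=
  (AddCommGrpCat.mono_iff_injective _).1 inferInstance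

theorem d_iCycles (j : ℕ) (z : C.cycles k) : C.d k j (C.iCycles k z) = 0 := by
  rw [← ConcreteCategory.comp_apply, iCycles_d]
  rfl

theorem exists_iCycles_eq (j : ℕ) (hj : (ComplexShape.down ℕ).next k = j) (x : C.X k)
    (hx : C.d k j x = 0) : ∃ z, C.iCycles k z = x :=
  (ShortComplex.ab_exact_iff _).1 (ShortComplex.exact_of_f_is_kernel
    (ShortComplex.mk (C.iCycles k) (C.d k j) (by simp)) (C.cyclesIsKernel k j hj)) x hx

theorem homologyπ_eq_zero_iff (z : C.cycles k) :
    C.homologyπ k z = 0 ↔ ∃ y, C.d (k + 1) k y = C.iCycles k z := by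
  constructor
  · intro h
    obtain ⟨y, hy⟩ := (ShortComplex.ab_exact_iff _).1 (ShortComplex.exact_of_g_is_cokernel
      (ShortComplex.mk (C.toCycles (k + 1) k) (C.homologyπ k) (by simp))
      (C.homologyIsCokernel (k + 1) k (by simp))) z h
    refine ⟨y, ?_⟩
    have : C.toCycles (k + 1) k y = z := hy
    rw [← this, ← ConcreteCategory.comp_apply, toCycles_i]
  · rintro ⟨y, hy⟩
    have : C.toCycles (k + 1) k y = z := iCycles_injective k (by
      rw [← ConcreteCategory.comp_apply, toCycles_i, hy])
    rw [← this, ← ConcreteCategory.comp_apply, toCycles_comp_homologyπ]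
    rfl

theorem homologyMap_homologyπ (z : C.cycles k) :
    homologyMap f k (C.homologyπ k z) = D.homologyπ k (cyclesMap f k z) := by
  rw [← ConcreteCategory.comp_apply, homologyπ_naturality]
  rfl

theorem iCycles_cyclesMap (z : C.cycles k) :
    D.iCycles k (cyclesMap f k z) = f.f k (C.iCycles k z) := by
  rw [← ConcreteCategory.comp_apply, cyclesMap_i]
  rfl

theorem homologyMap_eq_zero_iff (j : ℕ) (hj : (ComplexShape.down ℕ).next k = j) :
    homologyMap f k = 0 ↔ ∀ x, C.d k j x = 0 → ∃ y, D.d (k + 1) k y = f.f k x := by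
  constructor
  · intro h x hx
    obtain ⟨z, rfl⟩ := exists_iCycles_eq k j hj x hx
    rw [← iCycles_cyclesMap, ← homologyπ_eq_zero_iff, ← homologyMap_homologyπ, h]
    rfl
  · intro h
    ext x
    obtain ⟨z, rfl⟩ := exists_homologyπ_eq k x
    rw [homologyMap_homologyπ]
    refine (homologyπ_eq_zero_iff k _).2 ?_
    rw [iCycles_cyclesMap]
    exact h _ (d_iCycles k j z)

theorem epi_homologyMap (j : ℕ) (hj : (ComplexShape.down ℕ).next k = j)
    (h : ∀ y, D.d k j y = 0 → ∃ x b, C.d k j x = 0 ∧ y - D.d (k + 1) k b = f.f k x) :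
    Epi (homologyMap f k) := by
  refine (AddCommGrpCat.epi_iff_surjective _).2 fun y => ?_
  obtain ⟨w, rfl⟩ := exists_homologyπ_eq k y
  obtain ⟨x, b, hx, hb⟩ := h _ (d_iCycles k j w)
  obtain ⟨z, rfl⟩ := exists_iCycles_eq k j hj x hx
  refine ⟨C.homologyπ k z, ?_⟩
  rw [homologyMap_homologyπ, eq_comm, ← sub_eq_zero, ← map_sub]
  refine (homologyπ_eq_zero_iff k _).2 ⟨b, ?_⟩
  rw [map_sub, iCycles_cyclesMap, ← hb, sub_sub_cancel]

theorem mono_homologyMap (j : ℕ)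
    (h : ∀ x, C.d k j x = 0 → ∀ b, D.d (k + 1) k b = f.f k x → ∃ y, C.d (k + 1) k y = x) :
    Mono (homologyMap f k) := by
  refine (AddCommGrpCat.mono_iff_injective _).2 ((injective_iff_map_eq_zero _).2 fun x hx => ?_)
  obtain ⟨z, rfl⟩ := exists_homologyπ_eq k x
  change homologyMap f k (C.homologyπ k z) = 0 at hx
  rw [homologyMap_homologyπ] at hx
  obtain ⟨b, hb⟩ := (homologyπ_eq_zero_iff k _).1 hx
  rw [iCycles_cyclesMap] at hb
  exact (homologyπ_eq_zero_iff k z).2 (h _ (d_iCycles k j z) b hb)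

end Homology

/-! ### The singular chain complexes in terms of singular simplices -/

section Bridge

variable (X Y : LipMet.{u}) (n : ℕ)

/-- The continuous map underlying an `n`-simplex of the singular simplicial set. -/
def singSimplex : (singSSet.obj X).obj (Opposite.op (SimplexCategory.mk n)) → C(Simplex n, X) :=
  TopCat.toSSetObjEquiv (TopCat.of X) (Opposite.op (SimplexCategory.mk n))

/-- The continuous map underlying a singular Lipschitz `n`-simplex. -/
def lipSimplex : (lipSSet.obj X).obj (Opposite.op (SimplexCategory.mk n)) → C(Simplex n, X) :=
  fun σ => singSimplex X n σ.1

/-- The group of singular `n`-chains, as a free abelian group. -/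
def singIso : (singChains.obj X).X n ⟶ AddCommGrpCat.of (SChain X n) :=
  chainHom _ (singSimplex X n)

/-- The embedding of the group of singular Lipschitz `n`-chains into the free abelian group of
singular chains. -/
def lipEmb : (lipChains.obj X).X n ⟶ AddCommGrpCat.of (SChain X n) :=
  chainHom _ (lipSimplex X n)

theorem range_singSimplex : Set.range (singSimplex X n) = Set.univ :=
  (TopCat.toSSetObjEquiv (TopCat.of X) (Opposite.op (SimplexCategory.mk n))).surjective.range_eq

theorem range_lipSimplex : Set.range (lipSimplex X n) = lip X n := by
  ext σ
  constructor
  · rintro ⟨τ, rfl⟩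
    exact τ.2
  · intro h
    obtain ⟨τ, rfl⟩ : ∃ τ, singSimplex X n τ = σ :=
      (TopCat.toSSetObjEquiv (TopCat.of X) (Opposite.op (SimplexCategory.mk n))).surjective σ
    exact ⟨⟨τ, h⟩, rfl⟩

theorem singIso_injective : Function.Injective (singIso X n) :=
  chainHom_injective
    (TopCat.toSSetObjEquiv (TopCat.of X) (Opposite.op (SimplexCategory.mk n))).injective

theorem lipEmb_injective : Function.Injective (lipEmb X n) :=
  chainHom_injective fun _ _ h => Subtype.ext
    ((TopCat.toSSetObjEquiv (TopCat.of X) (Opposite.op (SimplexCategory.mk n))).injective h)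

theorem exists_singIso_eq (c : SChain X n) : ∃ x, singIso X n x = c :=
  exists_chainHom_eq _ (by rw [range_singSimplex]; exact mem_chainsOn_univ c)

theorem exists_lipEmb_eq {c : SChain X n} (hc : c ∈ chainsOn (lip X n)) :
    ∃ x, lipEmb X n x = c :=
  exists_chainHom_eq _ (by rwa [range_lipSimplex])

theorem lipEmb_mem (x : (lipChains.obj X).X n) : lipEmb X n x ∈ chainsOn (lip X n) := by
  rw [← range_lipSimplex]
  exact chainHom_mem _ x

theorem singSimplex_δ (σ : (singSSet.obj X).obj (Opposite.op (SimplexCategory.mk (n + 1))))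
    (i : Fin (n + 2)) :
    singSimplex X n ((singSSet.obj X).δ i σ) = (singSimplex X (n + 1) σ).comp (faceMap i) :=
  ContinuousMap.ext fun z => TopCat.toSSetObjEquiv_δ_apply (X := TopCat.of X) σ i z

theorem lipSimplex_δ (σ : (lipSSet.obj X).obj (Opposite.op (SimplexCategory.mk (n + 1))))
    (i : Fin (n + 2)) :
    lipSimplex X n ((lipSSet.obj X).δ i σ) = (lipSimplex X (n + 1) σ).comp (faceMap i) :=
  singSimplex_δ X n σ.1 i

theorem singIso_d (x : (singChains.obj X).X (n + 1)) :
    singIso X n ((singChains.obj X).d (n + 1) n x) = SChain.d X n (singIso X (n + 1) x) :=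
  chainHom_d (K := singSSet.obj X) (singSimplex X (n + 1)) (singSimplex X n) (SChain.d X n)
    (fun σ => by simp only [SChain.d_gen, singSimplex_δ]) x

theorem lipEmb_d (x : (lipChains.obj X).X (n + 1)) :
    lipEmb X n ((lipChains.obj X).d (n + 1) n x) = SChain.d X n (lipEmb X (n + 1) x) :=
  chainHom_d (K := lipSSet.obj X) (lipSimplex X (n + 1)) (lipSimplex X n) (SChain.d X n)
    (fun σ => by simp only [SChain.d_gen, lipSimplex_δ]) x

theorem singIso_incl (x : (lipChains.obj X).X n) :
    singIso X n ((chainsIncl.app X).f n x) = lipEmb X n x :=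
  chainHom_map _ _ _ LinearMap.id (fun _ => rfl) x

variable {X Y}

/-- The continuous map underlying a locally Lipschitz map. -/
def LipMet.Hom.toC (f : X ⟶ Y) : C(X, Y) := ⟨f.toFun, f.locallyLipschitz.continuous⟩

theorem singIso_map (f : X ⟶ Y) (x : (singChains.obj X).X n) :
    singIso Y n ((singChains.map f).f n x) = SChain.map (LipMet.Hom.toC f) n (singIso X n x) :=
  chainHom_map _ _ _ _ (fun σ => SChain.map_gen (LipMet.Hom.toC f) n (singSimplex X n σ)) x

theorem lipEmb_map (f : X ⟶ Y) (x : (lipChains.obj X).X n) :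
    lipEmb Y n ((lipChains.map f).f n x) = SChain.map (LipMet.Hom.toC f) n (lipEmb X n x) :=
  chainHom_map _ _ _ _ (fun σ => SChain.map_gen (LipMet.Hom.toC f) n (lipSimplex X n σ)) x

theorem augmentation_lipSSet (x : (lipChains.obj X).X 0) :
    (augmentation (lipSSet.obj X) x).down = SChain.aug X (lipEmb X 0 x) := by
  have := chains_hom_congr (K := lipSSet.obj X) (M := ULift.{u} ℤ)
    (φ := (augmentation (lipSSet.obj X)).hom)
    (ψ := (AddEquiv.ulift.symm : ℤ ≃+ ULift.{u} ℤ).toAddMonoidHom.comp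
      ((SChain.aug X).toAddMonoidHom.comp (lipEmb X 0).hom)) (fun σ => ?_) x
  · exact congrArg ULift.down this
  · refine (ConcreteCategory.congr_hom (ι_augmentation (lipSSet.obj X) σ) ⟨1⟩).trans ?_
    have h : lipEmb X 0 (chainGen σ) = gen (lipSimplex X 0 σ) := chainHom_chainGen _ σ
    refine ULift.ext _ _ ?_
    change 1 = SChain.aug X (lipEmb X 0 (chainGen σ))
    rw [h, SChain.aug_gen]

theorem singHomology_map_eq_zero_iff (f : X ⟶ Y) : (singHomology (n + 1)).map f = 0 ↔
    ∀ c, SChain.d X n c = 0 →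
      ∃ b, SChain.d Y (n + 1) b = SChain.map (LipMet.Hom.toC f) (n + 1) c := by
  refine (homologyMap_eq_zero_iff (singChains.map f) (n + 1) n (by simp)).trans
    ⟨fun h c hc => ?_, fun h x hx => ?_⟩
  · obtain ⟨x, rfl⟩ := exists_singIso_eq X _ c
    obtain ⟨y, hy⟩ := h x (singIso_injective X n (by rw [singIso_d, hc, map_zero]))
    exact ⟨singIso Y _ y, by rw [← singIso_d, hy, singIso_map]⟩
  · obtain ⟨b, hb⟩ := h (singIso X _ x) (by rw [← singIso_d, hx, map_zero])
    obtain ⟨y, rfl⟩ := exists_singIso_eq Y _ b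
    exact ⟨y, singIso_injective Y _ (by rw [singIso_d, hb, singIso_map])⟩

/-- In the augmented complex the `n`-chains are in degree `n + 1`. -/
theorem redLipHomology_map_eq_zero_iff (f : X ⟶ Y) : (redLipHomology n).map f = 0 ↔
    ∀ c ∈ chainsOn (lip X n), SChain.IsReducedCycle n c →
      ∃ b ∈ chainsOn (lip Y (n + 1)),
        SChain.d Y n b = SChain.map (LipMet.Hom.toC f) n c := by
  have hcyc : ∀ x : (lipChains.obj X).X n,
      (augChains.obj (lipSSet.obj X)).d (n + 1) n x = 0 ↔
        SChain.IsReducedCycle n (lipEmb X n x) := by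
    intro x
    cases n with
    | zero =>
      change augmentation (lipSSet.obj X) x = 0 ↔ SChain.aug X (lipEmb X 0 x) = 0
      rw [← augmentation_lipSSet]
      exact ⟨fun h => by rw [h]; rfl, fun h => ULift.ext _ _ h⟩
    | succ n =>
      change (lipChains.obj X).d (n + 1) n x = 0 ↔ SChain.d X n (lipEmb X (n + 1) x) = 0
      rw [← lipEmb_d]
      exact ⟨fun h => by rw [h, map_zero], fun h => lipEmb_injective X n (by rw [h, map_zero])⟩
  refine (homologyMap_eq_zero_iff (augChains.map (lipSSet.map f)) (n + 1) n (by simp)).trans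
    ⟨fun h c hc hc' => ?_, fun h (x : (lipChains.obj X).X n) hx => ?_⟩
  · obtain ⟨x, rfl⟩ := exists_lipEmb_eq X _ hc
    obtain ⟨y, hy⟩ : ∃ y : (lipChains.obj Y).X (n + 1),
      (lipChains.obj Y).d (n + 1) n y = (lipChains.map f).f n x := h x ((hcyc x).2 hc')
    exact ⟨lipEmb Y _ y, lipEmb_mem Y _ y, by rw [← lipEmb_d, ← lipEmb_map, hy]⟩
  · obtain ⟨b, hb, hdb⟩ := h (lipEmb X _ x) (lipEmb_mem X _ x) ((hcyc x).1 hx)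
    obtain ⟨y, rfl⟩ := exists_lipEmb_eq Y _ hb
    have : (lipChains.obj Y).d (n + 1) n y = (lipChains.map f).f n x :=
      lipEmb_injective Y _ (by rw [lipEmb_d, lipEmb_map, hdb])
    exact ⟨y, this⟩

end Bridge

/-! ### Chains in a subset -/

section Subset

variable {X : LipMet.{u}} (U : Set X) (n : ℕ)

/-- The chains of a subset, as chains of the whole space. -/
def extend : SChain (X.sub U) n →ₗ[ℤ] SChain X n := SChain.map (LipMet.Hom.toC (X.incl U)) n

theorem extend_gen (σ : C(Simplex n, X.sub U)) :
    extend U n (gen σ) = gen ((LipMet.Hom.toC (X.incl U)).comp σ) :=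
  SChain.map_gen _ _ _

theorem extend_d (c : SChain (X.sub U) (n + 1)) :
    extend U n (SChain.d _ n c) = SChain.d X n (extend U (n + 1) c) :=
  SChain.map_d _ _ _

theorem extend_injective : Function.Injective (extend U n) := by
  have h : extend U n = Finsupp.lmapDomain ℤ ℤ (fun σ => (LipMet.Hom.toC (X.incl U)).comp σ) :=
    hom_ext fun σ => by rw [extend_gen]; simp [gen]
  rw [h]
  refine Finsupp.mapDomain_injective fun σ τ h => ?_
  ext t
  exact Subtype.ext (DFunLike.congr_fun h t)

theorem extend_mem (c : SChain (X.sub U) n) : extend U n c ∈ chainsOn (inSet U n) := by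
  refine map_mem_of_chainsOn (fun σ _ => ?_) (mem_chainsOn_univ c)
  rw [extend_gen]
  exact gen_mem_chainsOn fun t => (σ t).2

theorem extend_mem_lip {c : SChain (X.sub U) n} (hc : c ∈ chainsOn (lip (X.sub U) n)) :
    extend U n c ∈ chainsOn (lipIn U n) := by
  refine map_mem_of_chainsOn (fun σ hσ => ?_) hc
  obtain ⟨K, hK⟩ := hσ
  rw [extend_gen]
  exact gen_mem_chainsOn (s := lipIn U n) ⟨fun t => (σ t).2, K, hK⟩

theorem exists_extend_eq {c : SChain X n} (hc : c ∈ chainsOn (inSet U n)) :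
    ∃ b, extend U n b = c := by
  refine (Submodule.span_le (p := LinearMap.range (extend U n))).2 ?_ hc
  rintro _ ⟨σ, hσ, rfl⟩
  exact ⟨gen (⟨fun t => ⟨σ t, hσ t⟩, by fun_prop⟩ : C(Simplex n, U)), extend_gen U n _⟩

theorem exists_lip_extend_eq {c : SChain X n} (hc : c ∈ chainsOn (lipIn U n)) :
    ∃ b ∈ chainsOn (lip (X.sub U) n), extend U n b = c := by
  refine (Submodule.span_le (p := (chainsOn (lip (X.sub U) n)).map (extend U n))).2 ?_ hc
  rintro _ ⟨σ, ⟨hσ, K, hK⟩, rfl⟩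
  exact ⟨gen (⟨fun t => ⟨σ t, hσ t⟩, by fun_prop⟩ : C(Simplex n, U)),
    gen_mem_chainsOn ⟨K, hK⟩, extend_gen U n _⟩

theorem isReducedCycle_extend {c : SChain (X.sub U) n} :
    SChain.IsReducedCycle n (extend U n c) ↔ SChain.IsReducedCycle n c := by
  cases n with
  | zero =>
    change SChain.aug X (SChain.map _ 0 c) = 0 ↔ SChain.aug _ c = 0
    rw [SChain.aug_map]
  | succ n =>
    change SChain.d X n (extend U (n + 1) c) = 0 ↔ SChain.d _ n c = 0
    rw [← extend_d]
    exact ⟨fun h => extend_injective U n (by rw [h, map_zero]), fun h => by rw [h, map_zero]⟩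

theorem extend_subIncl {U V : Set X} (h : U ⊆ V) (c : SChain (X.sub U) n) :
    extend V n (SChain.map (LipMet.Hom.toC (X.subIncl h)) n c) = extend U n c := by
  refine hom_congr (f := extend V n ∘ₗ SChain.map (LipMet.Hom.toC (X.subIncl h)) n)
    (g := extend U n) (fun σ => ?_) c
  rw [LinearMap.comp_apply, SChain.map_gen, extend_gen, extend_gen]
  rfl

theorem locally_singBounds (h : IsLocallyTrivial (singHomology (n + 1)) X) :
    Locally X (SingBounds X (n + 1)) := by
  intro x V hV hx
  obtain ⟨U, hUV, hU, hxU, h⟩ := h x V hV hx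
  refine ⟨U, hUV, hU, hxU, fun z hz hz' => ?_⟩
  obtain ⟨c, rfl⟩ := exists_extend_eq U _ hz
  have hc : SChain.d _ n c = 0 := (isReducedCycle_extend U (n + 1)).1 hz'
  obtain ⟨b, hb⟩ := (singHomology_map_eq_zero_iff n _).1 h c hc
  exact ⟨extend V _ b, extend_mem V _ b, by rw [← extend_d, hb, extend_subIncl]⟩

theorem locally_lipBounds (h : IsLocallyTrivial (redLipHomology n) X) :
    Locally X (LipBounds X n) := by
  intro x V hV hx
  obtain ⟨U, hUV, hU, hxU, h⟩ := h x V hV hx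
  refine ⟨U, hUV, hU, hxU, fun z hz hz' => ?_⟩
  obtain ⟨c, hc, rfl⟩ := exists_lip_extend_eq U _ hz
  obtain ⟨b, hb, hdb⟩ :=
    (redLipHomology_map_eq_zero_iff n _).1 h c hc ((isReducedCycle_extend U n).1 hz')
  exact ⟨extend V _ b, extend_mem_lip V _ hb, by rw [← extend_d, hdb, extend_subIncl]⟩

end Subset

/-! ### The comparison for spaces -/

section Absolute

variable {X : LipMet.{u}} {m : ℕ}

theorem isCycle_singIso {x : (singChains.obj X).X m}
    (hx : (singChains.obj X).d m ((ComplexShape.down ℕ).next m) x = 0) :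
    SChain.IsCycle m (singIso X m x) := by
  cases m with
  | zero => trivial
  | succ m =>
    rw [ChainComplex.next_nat_succ] at hx
    change SChain.d X m (singIso X (m + 1) x) = 0
    rw [← singIso_d, hx, map_zero]

/-- In degree `0` there is no condition: every `0`-chain is Lipschitz. -/
theorem epi_homologyMap_chainsIncl
    (hL : ∀ j < m, IsLocallyTrivial (redLipHomology j) X)
    (hS : ∀ k, 1 ≤ k → k ≤ m → IsLocallyTrivial (singHomology k) X) :
    Epi (HomologicalComplex.homologyMap (chainsIncl.app X) m) := by
  refine epi_homologyMap _ m _ rfl fun y hy => ?_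
  obtain ⟨b, hb⟩ := exists_sub_d_mem_lip m (fun k hk => locally_quotBounds
    (locally_lipBounds k (hL k hk)) (locally_singBounds k (hS (k + 1) (by omega) hk))) _
    (isCycle_singIso hy)
  obtain ⟨x, hx⟩ := exists_lipEmb_eq X m hb
  obtain ⟨b, rfl⟩ := exists_singIso_eq X _ b
  have key : y - (singChains.obj X).d (m + 1) m b = (chainsIncl.app X).f m x :=
    singIso_injective X m (by rw [map_sub, singIso_d, singIso_incl, hx])
  refine ⟨x, b, ?_, key⟩
  cases m with
  | zero => simp
  | succ m =>
    rw [ChainComplex.next_nat_succ] at hy ⊢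
    refine lipEmb_injective X m ?_
    rw [lipEmb_d, hx, map_sub, SChain.d_d, ← singIso_d, hy]
    simp

theorem mono_homologyMap_chainsIncl
    (hL : ∀ j ≤ m, IsLocallyTrivial (redLipHomology j) X)
    (hS : ∀ k, 1 ≤ k → k ≤ m → IsLocallyTrivial (singHomology k) X) :
    Mono (HomologicalComplex.homologyMap (chainsIncl.app X) m) := by
  refine mono_homologyMap _ m ((ComplexShape.down ℕ).next m) fun x _ b hb => ?_
  have hb' : SChain.d X m (singIso X (m + 1) b) = lipEmb X m x := by
    rw [← singIso_d, hb, singIso_incl]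
  obtain ⟨c, hc, hdc⟩ := exists_lip_d_eq m (fun k hk => locally_quotBounds
    (locally_lipBounds k (hL k hk.le)) (locally_singBounds k (hS (k + 1) (by omega) hk)))
    (locally_lipBounds m (hL m le_rfl)) (singIso X (m + 1) b) (by rw [hb']; exact lipEmb_mem X m x)
  obtain ⟨y, rfl⟩ := exists_lipEmb_eq X _ hc
  exact ⟨y, lipEmb_injective X m (by rw [lipEmb_d, hdc, hb'])⟩

end Absolute

/-! ### The comparison for pairs -/

section Relative

theorem mono_singChains_map_incl (P : LipPair.{u}) : Mono (singChains.map P.incl) := by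
  have : ∀ n, Mono ((singChains.map P.incl).f n) := fun n => by
    refine (AddCommGrpCat.mono_iff_injective _).2 fun x y h => singIso_injective P.subspace n
      (extend_injective P.subset n ?_)
    have h' := congrArg (singIso P.space n) h
    rwa [singIso_map, singIso_map] at h'
  exact HomologicalComplex.mono_of_mono_f _ this

theorem mono_lipChains_map_incl (P : LipPair.{u}) : Mono (lipChains.map P.incl) := by
  have : ∀ n, Mono ((lipChains.map P.incl).f n) := fun n => by
    refine (AddCommGrpCat.mono_iff_injective _).2 fun x y h => lipEmb_injective P.subspace n
      (extend_injective P.subset n ?_)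
    have h' := congrArg (lipEmb P.space n) h
    rwa [lipEmb_map, lipEmb_map] at h'
  exact HomologicalComplex.mono_of_mono_f _ this

/-- The sequence `0 → S_*(A) → S_*(X) → S_*(X, A) → 0` of a pair. -/
def pairSequence (S : LipMet.{u} ⥤ ChainComplex AddCommGrpCat.{u} ℕ) (P : LipPair.{u}) :
    ShortComplex (ChainComplex AddCommGrpCat.{u} ℕ) :=
  ShortComplex.mk (S.map P.incl) (cokernel.π (S.map P.incl)) (cokernel.condition _)

theorem pairSequence_shortExact (S : LipMet.{u} ⥤ ChainComplex AddCommGrpCat.{u} ℕ)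
    (P : LipPair.{u}) (h : Mono (S.map P.incl)) : (pairSequence S P).ShortExact :=
  { exact := ShortComplex.exact_cokernel _
    mono_f := h
    epi_g := inferInstanceAs (Epi (cokernel.π (S.map P.incl))) }

/-- The map of sequences of a pair induced by a natural transformation. -/
def pairSequenceMap {S T : LipMet.{u} ⥤ ChainComplex AddCommGrpCat.{u} ℕ} (α : S ⟶ T)
    (P : LipPair.{u}) : pairSequence S P ⟶ pairSequence T P where
  τ₁ := α.app P.subspace
  τ₂ := α.app P.space
  τ₃ := (relChainsMap α).app P
  comm₁₂ := (α.naturality P.incl).symm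
  comm₂₃ := (cokernel.π_desc _ _ _).symm

/-- The five lemma for the long exact sequences of a pair. -/
theorem isIso_inclusionTrans_app {m : ℕ} {P : LipPair.{u}} (hP : locallyTrivialPairs m P) :
    IsIso ((inclusionTrans m).app P) := by
  obtain ⟨hLX, hSX, hLA, hSA⟩ := hP
  refine HomologicalComplex.HomologySequence.isIso_homologyMap_τ₃ (pairSequenceMap chainsIncl P)
    (pairSequence_shortExact _ P (mono_lipChains_map_incl P))
    (pairSequence_shortExact _ P (mono_singChains_map_incl P)) m ?_ ?_ ?_ ?_
  · exact epi_homologyMap_chainsIncl hLA hSA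
  · have := epi_homologyMap_chainsIncl (fun j hj => hLX j hj.le) hSX
    have := mono_homologyMap_chainsIncl hLX hSX
    exact isIso_of_mono_of_epi (HomologicalComplex.homologyMap (chainsIncl.app P.space) m)
  · rintro j (rfl : j + 1 = m)
    have := epi_homologyMap_chainsIncl (X := P.subspace) (m := j) (fun i hi => hLA i (by omega))
      (fun k hk hk' => hSA k hk (by omega))
    have := mono_homologyMap_chainsIncl (X := P.subspace) (m := j) (fun i hi => hLA i (by omega))
      (fun k hk hk' => hSA k hk (by omega))
    exact isIso_of_mono_of_epi (HomologicalComplex.homologyMap (chainsIncl.app P.subspace) j)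
  · rintro j (rfl : j + 1 = m)
    exact mono_homologyMap_chainsIncl (fun i hi => hLX i (by omega))
      (fun k hk hk' => hSX k hk (by omega))

end Relative

/-! ### Weakly locally Lipschitz contractible spaces -/

section WLLC

variable {X : LipMet.{u}}

/-- Reduced cycles in `V` bound in `U`, and Lipschitz ones bound Lipschitz chains. -/
theorem exists_bound_of_contractible {V U : Set X} {x₀ : U} (h : IsLipschitzContractibleTo V U x₀)
    (hVU : V ⊆ U) (k : ℕ) (c : SChain (X.sub V) k) (hc : SChain.IsReducedCycle k c) :
    ∃ b, (c ∈ chainsOn (lip (X.sub V) k) → b ∈ chainsOn (lip (X.sub U) (k + 1))) ∧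
      SChain.d (X.sub U) k b = SChain.map (LipMet.Hom.toC (X.subIncl hVU)) k c := by
  obtain ⟨_, h, ⟨K, hK⟩, h0, h1⟩ := h
  exact SChain.exists_d_eq_map_of_contraction (V := X.sub V) (U := X.sub U)
    (h := ⟨h, hK.continuous⟩) (f := LipMet.Hom.toC (X.subIncl hVU)) ⟨K, hK⟩ h0 h1 k c hc

theorem IsWLLC.isLocallyTrivial_redLipHomology (h : IsWLLC X) (j : ℕ) :
    IsLocallyTrivial (redLipHomology j) X := by
  intro x U hU hx
  obtain ⟨V, hV, hxV, hVU, x₀, h⟩ := h x U hU hx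
  refine ⟨V, hVU, hV, hxV, (redLipHomology_map_eq_zero_iff j _).2 fun c hc hc' => ?_⟩
  obtain ⟨b, hb, hdb⟩ := exists_bound_of_contractible h hVU j c hc'
  exact ⟨b, hb hc, hdb⟩

theorem IsWLLC.isLocallyTrivial_singHomology (h : IsWLLC X) (k : ℕ) :
    IsLocallyTrivial (singHomology (k + 1)) X := by
  intro x U hU hx
  obtain ⟨V, hV, hxV, hVU, x₀, h⟩ := h x U hU hx
  refine ⟨V, hVU, hV, hxV, (singHomology_map_eq_zero_iff k _).2 fun c hc => ?_⟩
  obtain ⟨b, -, hdb⟩ := exists_bound_of_contractible h hVU (k + 1) c hc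
  exact ⟨b, hdb⟩

theorem locallyTrivialPairs_of_wllcPairs (m : ℕ) {P : LipPair.{u}} (hP : wllcPairs P) :
    locallyTrivialPairs m P := by
  refine ⟨fun j _ => hP.1.isLocallyTrivial_redLipHomology j, fun k hk _ => ?_,
    fun j _ => hP.2.isLocallyTrivial_redLipHomology j, fun k hk _ => ?_⟩
  · obtain ⟨k, rfl⟩ := Nat.exists_eq_add_of_le' hk
    exact hP.1.isLocallyTrivial_singHomology k
  · obtain ⟨k, rfl⟩ := Nat.exists_eq_add_of_le' hk
    exact hP.2.isLocallyTrivial_singHomology k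

end WLLC

end LipHomology

end

theorem mainTheorem9 (m : ℕ) :
    IsIso (Functor.whiskerLeft (LipHomology.locallyTrivialPairs.{u} m).ι
      (LipHomology.inclusionTrans.{u} m)) ∧
    IsIso (Functor.whiskerLeft LipHomology.wllcPairs.{u}.ι
      (LipHomology.inclusionTrans.{u} m)) := by
  constructor
  · refine (NatTrans.isIso_iff_isIso_app _).2 fun P => ?_
    exact LipHomology.isIso_inclusionTrans_app P.2
  · refine (NatTrans.isIso_iff_isIso_app _).2 fun P => ?_
    exact LipHomology.isIso_inclusionTrans_app
      (LipHomology.locallyTrivialPairs_of_wllcPairs m P.2)
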